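/- Throughout, Hilbert spaces are finite-dimensional and $\log$ is to base $2$. Write $\beta=\cos^2(\pi/8)$ and $h(p)=-p\log p-(1-p)\log(1-p)$ with $0\log 0=0$. **Robustness.** Let $\mathcal S$ be the set of separable states on $L\otimes R$ (convex combinations of product states). For a density matrix $\rho_{LR}$ put $$\mathcal R(\rho)=\inf\Big\{s\ge 0:\ \exists\,\sigma\in\mathcal S,\ \tfrac{1}{1+s}\rho+\tfrac{s}{1+s}\sigma\in\mathcal S\Big\},\qquad r(\rho)=\log(\mathcal R(\rho)+1).$$ **Task $N^{n,\delta}_{BB84}$.** Let $\theta,x\in\{0,1\}^n$ be independent and uniformly random. Alice (left) receives the $n$ qubits $\bigotimes_i H^{\theta_i}|x_i\rangle$, where $H$ is the Hadamard matrix, and Bob (right) receives the classical string $\theta$. They hold the resource state $\rho_{LR}$ ($L$ with Alice, $R$ with Bob) and run a non-local quantum computation: quantum channels $\mathcal V_{AL\to K_aM_b}\otimes\mathcal V_{RB\to M_aK_b}$ act on the inputs ($A$ for Alice, $B$ for Bob) and the resource, the messages $M_a,M_b$ are exchanged in one simultaneous round, and then channels $\mathcal W_{K_aM_a\to A'}\otimes\mathcal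 W_{K_bM_b\to B'}$ produce strings $y\in\{0,1\}^n$ on the left and $z\in\{0,1\}^n$ on the right. The systems $K_a,K_b,M_a,M_b$ have arbitrary finite dimensions. Round $i$ fails unless $y_i=z_i=x_i$. The task is completed if at most $\delta n$ rounds fail. **Theorem.** Let $n\in\mathbb N$, $0\le\delta\le\frac12$, $\gamma<1$, and let $\rho_{LR}$ be a density matrix. If some such protocol with resource state $\rho$ completes $N^{n,\delta}_{BB84}$ with probability at least $1-\gamma$, then $$r(\rho)\ \ge\ -n\log\!\big(2^{h(\delta)}\beta\big)+\log(1-\gamma).$$ -/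

import Mathlib

open scoped Matrix Kronecker ComplexOrder

noncomputable section

namespace NLQC

/-! ### States, separable states, robustness of entanglement -/

section States

variable {L R : Type*} [Fintype L] [Fintype R]

/-- Density matrices on the finite-dimensional Hilbert space with orthonormal basis indexed by `L`. -/
def IsDensity (ρ : Matrix L L ℂ) : Prop :=
  ρ.PosSemidef ∧ ρ.trace = 1

/-- Product states `ρ_L ⊗ ρ_R`. -/
def productStates (L R : Type*) [Fintype L] [Fintype R] : Set (Matrix (L × R) (L × R) ℂ) :=
  {κ | ∃ (σ : Matrix L L ℂ) (τ : Matrix R R ℂ), IsDensity σ ∧ IsDensity τ ∧ κ = σ ⊗ₖ τ}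

/-- Separable states: finite convex combinations of product states. -/
def separableStates (L R : Type*) [Fintype L] [Fintype R] : Set (Matrix (L × R) (L × R) ℂ) :=
  convexHull ℝ (productStates L R)

/-- The set of all `s ≥ 0` such that mixing `ρ`, with weights `1/(1+s)` and `s/(1+s)`, with some
separable state gives a separable state. -/
def robustnessSet (ρ : Matrix (L × R) (L × R) ℂ) : Set ℝ :=
  {s | 0 ≤ s ∧ ∃ σ ∈ separableStates L R,
    (1 / (1 + s)) • ρ + (s / (1 + s)) • σ ∈ separableStates L R}

/-- The robustness of entanglement. The set is non-empty for every state `ρ`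
(see `robustnessSet_nonempty`) and bounded below by `0`. -/
def robustness (ρ : Matrix (L × R) (L × R) ℂ) : ℝ :=
  sInf (robustnessSet ρ)

/-- The log-robustness of entanglement `r(ρ) = log₂ (robustness ρ + 1)`. -/
def logRobustness (ρ : Matrix (L × R) (L × R) ℂ) : ℝ :=
  Real.logb 2 (robustness ρ + 1)

theorem isDensity_smul {A : Matrix L L ℂ} (hA : A.PosSemidef) :
    A = 0 ∨ ∃ t : ℝ, 0 < t ∧ ∃ σ, IsDensity σ ∧ A = t • σ := by
  by_cases h : A.trace = 0
  · exact Or.inl (hA.trace_eq_zero_iff.1 h)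
  · right
    have h0 := hA.trace_nonneg
    obtain ⟨t, ht0, ht⟩ : ∃ t : ℝ, 0 ≤ t ∧ A.trace = t :=
      ⟨A.trace.re, (Complex.le_def.1 h0).1, Complex.ext rfl (Complex.le_def.1 h0).2.symm⟩
    have hne : t ≠ 0 := fun h' => h (by rw [ht, h']; simp)
    have hpos : 0 < t := lt_of_le_of_ne ht0 hne.symm
    refine ⟨t, hpos, t⁻¹ • A, ⟨hA.smul (by positivity), ?_⟩, ?_⟩
    · rw [Matrix.trace_smul, ht, Complex.real_smul, ← Complex.ofReal_mul, inv_mul_cancel₀ hne]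
      simp
    · rw [smul_smul, mul_inv_cancel₀ hne, one_smul]

/-- Tensor products of positive semidefinite matrices. -/
def psdProducts (L R : Type*) [Fintype L] [Fintype R] : Set (Matrix (L × R) (L × R) ℂ) :=
  {κ | ∃ (A : Matrix L L ℂ) (B : Matrix R R ℂ), A.PosSemidef ∧ B.PosSemidef ∧ κ = A ⊗ₖ B}

theorem separable_of_mem_closure {κ : Matrix (L × R) (L × R) ℂ}
    (hκ : κ ∈ AddSubmonoid.closure (psdProducts L R)) :
    κ = 0 ∨ ∃ t : ℝ, 0 < t ∧ ∃ σ ∈ separableStates L R, κ = t • σ := by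
  induction hκ using AddSubmonoid.closure_induction with
  | mem κ h =>
    obtain ⟨A, B, hA, hB, rfl⟩ := h
    rcases isDensity_smul hA with rfl | ⟨a, ha, σ, hσ, rfl⟩
    · left; simp
    rcases isDensity_smul hB with rfl | ⟨b, hb, τ, hτ, rfl⟩
    · left; simp
    right
    refine ⟨a * b, by positivity, σ ⊗ₖ τ, subset_convexHull ℝ _ ⟨σ, τ, hσ, hτ, rfl⟩, ?_⟩
    rw [Matrix.smul_kronecker, Matrix.kronecker_smul, smul_smul]
  | zero => exact Or.inl rfl
  | add x y _ _ hx hy =>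
    rcases hx with rfl | ⟨a, ha, σ, hσ, rfl⟩
    · simpa using hy
    rcases hy with rfl | ⟨b, hb, τ, hτ, rfl⟩
    · right; exact ⟨a, ha, σ, hσ, by simp⟩
    right
    refine ⟨a + b, by positivity, (a / (a + b)) • σ + (b / (a + b)) • τ,
      convex_convexHull ℝ _ hσ hτ (by positivity) (by positivity) ?_, ?_⟩
    · rw [← add_div, div_self (by positivity)]
    · rw [smul_add, smul_smul, smul_smul, mul_div_cancel₀ _ (by positivity : a + b ≠ 0),
        mul_div_cancel₀ _ (by positivity : a + b ≠ 0)]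

theorem exists_psd_sub [DecidableEq L] {A : Matrix L L ℂ} (hA : A.IsHermitian) :
    ∃ P Q : Matrix L L ℂ, P.PosSemidef ∧ Q.PosSemidef ∧ A = P - Q := by
  have h1 : (A + 1)ᴴ = A + 1 := by rw [Matrix.conjTranspose_add, hA.eq, Matrix.conjTranspose_one]
  have h2 : (A - 1)ᴴ = A - 1 := by rw [Matrix.conjTranspose_sub, hA.eq, Matrix.conjTranspose_one]
  have p1 := Matrix.posSemidef_conjTranspose_mul_self (A + 1)
  have p2 := Matrix.posSemidef_conjTranspose_mul_self (A - 1)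
  rw [h1] at p1
  rw [h2] at p2
  refine ⟨(1 / 4 : ℝ) • ((A + 1) * (A + 1)), (1 / 4 : ℝ) • ((A - 1) * (A - 1)),
    p1.smul (by norm_num), p2.smul (by norm_num), ?_⟩
  rw [← smul_sub]
  have : (A + 1) * (A + 1) - (A - 1) * (A - 1) = (4 : ℝ) • A := by
    have h4 : (4 : ℝ) • A = A + A + A + A := by
      rw [show (4 : ℝ) = 1 + 1 + 1 + 1 by norm_num]; simp only [add_smul, one_smul]
    rw [h4]; noncomm_ring
  rw [this, smul_smul]; norm_num

theorem kronecker_mem_closure [DecidableEq L] [DecidableEq R] {A : Matrix L L ℂ}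
    {B : Matrix R R ℂ} (hA : A.IsHermitian) (hB : B.IsHermitian) :
    A ⊗ₖ B ∈ AddSubgroup.closure (psdProducts L R) := by
  obtain ⟨P, Q, hP, hQ, rfl⟩ := exists_psd_sub hA
  obtain ⟨P', Q', hP', hQ', rfl⟩ := exists_psd_sub hB
  have e : (P - Q) ⊗ₖ (P' - Q') = P ⊗ₖ P' - P ⊗ₖ Q' - (Q ⊗ₖ P' - Q ⊗ₖ Q') := by
    ext i j; simp only [Matrix.kroneckerMap_apply, Matrix.sub_apply]; ring
  rw [e]
  have m : ∀ {A : Matrix L L ℂ} {B : Matrix R R ℂ}, A.PosSemidef → B.PosSemidef →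
      A ⊗ₖ B ∈ AddSubgroup.closure (psdProducts L R) :=
    fun hA hB => AddSubgroup.subset_closure ⟨_, _, hA, hB, rfl⟩
  exact sub_mem (sub_mem (m hP hP') (m hP hQ')) (sub_mem (m hQ hP') (m hQ hQ'))

theorem mem_closure_of_isHermitian [DecidableEq L] [DecidableEq R]
    {M : Matrix (L × R) (L × R) ℂ} (hM : M.IsHermitian) :
    M ∈ AddSubgroup.closure (psdProducts L R) := by
  have key : ∀ (X : Matrix L L ℂ) (Y : Matrix R R ℂ),
      (1 / 2 : ℝ) • (X ⊗ₖ Y + Xᴴ ⊗ₖ Yᴴ) ∈ AddSubgroup.closure (psdProducts L R) := by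
    intro X Y
    have e : (1 / 2 : ℝ) • (X ⊗ₖ Y + Xᴴ ⊗ₖ Yᴴ)
        = ((1 / 2 : ℝ) • (X + Xᴴ)) ⊗ₖ ((1 / 2 : ℝ) • (Y + Yᴴ))
          - ((1 / 2 : ℝ) • (Complex.I • (X - Xᴴ))) ⊗ₖ ((1 / 2 : ℝ) • (Complex.I • (Y - Yᴴ))) := by
      ext i j
      simp only [Matrix.kroneckerMap_apply, Matrix.sub_apply, Matrix.add_apply, Matrix.smul_apply,
        Complex.real_smul, smul_eq_mul]
      push_cast
      linear_combination (1 / 4 * (X i.1 j.1 - Xᴴ i.1 j.1) * (Y i.2 j.2 - Yᴴ i.2 j.2))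
        * Complex.I_mul_I
    rw [e]
    have h1 : ∀ {ι : Type _} (Z : Matrix ι ι ℂ), ((1 / 2 : ℝ) • (Z + Zᴴ)).IsHermitian := by
      intro ι Z
      simp [Matrix.IsHermitian, add_comm]
    have h2 : ∀ {ι : Type _} (Z : Matrix ι ι ℂ),
        ((1 / 2 : ℝ) • (Complex.I • (Z - Zᴴ))).IsHermitian := by
      intro ι Z
      ext i j
      simp [Matrix.conjTranspose_apply]
      ring
    have h3 : ∀ {ι : Type _} (Z : Matrix ι ι ℂ), ((1 / 2 : ℝ) • (Z + Zᴴ)).IsHermitian := by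
      intro ι Z
      simp [Matrix.IsHermitian, add_comm]
    have h4 : ∀ {ι : Type _} (Z : Matrix ι ι ℂ),
        ((1 / 2 : ℝ) • (Complex.I • (Z - Zᴴ))).IsHermitian := by
      intro ι Z
      ext i j
      simp [Matrix.conjTranspose_apply]
      ring
    exact sub_mem (kronecker_mem_closure (h1 X) (h3 Y)) (kronecker_mem_closure (h2 X) (h4 Y))
  have hsum : M = ∑ i : L, ∑ j : L, (1 / 2 : ℝ) •
      (Matrix.single i j (1 : ℂ) ⊗ₖ M.submatrix (fun r => (i, r)) (fun r => (j, r))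
        + (Matrix.single i j (1 : ℂ))ᴴ
          ⊗ₖ (M.submatrix (fun r => (i, r)) (fun r => (j, r)))ᴴ) := by
    ext ⟨a, r⟩ ⟨b, s⟩
    have hh : star (M (b, s) (a, r)) = M (a, r) (b, s) := hM.apply _ _
    simp only [Matrix.sum_apply, Matrix.smul_apply, Matrix.add_apply, Matrix.kroneckerMap_apply,
      Matrix.single_apply, Matrix.conjTranspose_apply, Matrix.submatrix_apply]
    simp only [smul_add, Finset.sum_add_distrib, ite_and, apply_ite star, star_one, star_zero,
      ite_mul, one_mul, zero_mul, smul_ite, smul_zero]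
    simp only [Finset.sum_ite_irrel, Finset.sum_const_zero, Finset.sum_ite_eq',
      Finset.mem_univ, if_true, hh, Complex.real_smul]
    push_cast
    ring
  rw [hsum]
  exact sum_mem fun i _ => sum_mem fun j _ => key _ _

theorem exists_sub_of_mem_closure {M : Matrix (L × R) (L × R) ℂ}
    (hM : M ∈ AddSubgroup.closure (psdProducts L R)) :
    ∃ P ∈ AddSubmonoid.closure (psdProducts L R), ∃ Q ∈ AddSubmonoid.closure (psdProducts L R),
      M = P - Q := by
  induction hM using AddSubgroup.closure_induction with
  | mem x h => exact ⟨x, AddSubmonoid.subset_closure h, 0, zero_mem _, by simp⟩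
  | zero => exact ⟨0, zero_mem _, 0, zero_mem _, by simp⟩
  | add x y _ _ hx hy =>
    obtain ⟨P, hP, Q, hQ, rfl⟩ := hx
    obtain ⟨P', hP', Q', hQ', rfl⟩ := hy
    exact ⟨P + P', add_mem hP hP', Q + Q', add_mem hQ hQ', by abel⟩
  | neg x _ hx =>
    obtain ⟨P, hP, Q, hQ, rfl⟩ := hx
    exact ⟨Q, hQ, P, hP, by abel⟩

theorem trace_of_mem_separableStates {σ : Matrix (L × R) (L × R) ℂ}
    (hσ : σ ∈ separableStates L R) : σ.trace = 1 := by
  have hc : Convex ℝ {σ : Matrix (L × R) (L × R) ℂ | σ.trace = 1} := by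
    intro x hx y hy a b _ _ hab
    change x.trace = 1 at hx
    change y.trace = 1 at hy
    change (a • x + b • y).trace = 1
    rw [Matrix.trace_add, Matrix.trace_smul, Matrix.trace_smul, hx, hy, ← add_smul, hab, one_smul]
  refine convexHull_min ?_ hc hσ
  rintro _ ⟨A, B, hA, hB, rfl⟩
  simp [Matrix.trace_kronecker, hA.2, hB.2]

/-- The robustness of entanglement of every state is finite. -/
theorem robustnessSet_nonempty {ρ : Matrix (L × R) (L × R) ℂ} (hρ : IsDensity ρ) :
    (robustnessSet ρ).Nonempty := by
  classical
  obtain ⟨P, hP, Q, hQ, hPQ⟩ :=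
    exists_sub_of_mem_closure (mem_closure_of_isHermitian hρ.1.isHermitian)
  have hP' : P = ρ + Q := by rw [hPQ]; abel
  rcases separable_of_mem_closure hQ with rfl | ⟨s, hs, σ, hσ, rfl⟩
  · rw [add_zero] at hP'
    subst hP'
    rcases separable_of_mem_closure hP with rfl | ⟨t, _, τ, hτ, rfl⟩
    · have := hρ.2
      simp at this
    · have h := hρ.2
      rw [Matrix.trace_smul, trace_of_mem_separableStates hτ, Complex.real_smul, mul_one] at h
      have ht : t = 1 := by exact_mod_cast h
      subst ht
      exact ⟨0, le_rfl, τ, hτ, by simpa using hτ⟩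
  · have htr : P.trace = ((1 + s : ℝ) : ℂ) := by
      rw [hP', Matrix.trace_add, hρ.2, Matrix.trace_smul, trace_of_mem_separableStates hσ]
      simp
    rcases separable_of_mem_closure hP with rfl | ⟨t, _, τ, hτ, rfl⟩
    · rw [Matrix.trace_zero] at htr
      have : (0 : ℝ) = 1 + s := by exact_mod_cast htr
      linarith
    · rw [Matrix.trace_smul, trace_of_mem_separableStates hτ, Complex.real_smul, mul_one] at htr
      have ht : t = 1 + s := by exact_mod_cast htr
      subst ht
      refine ⟨s, hs.le, σ, hσ, ?_⟩
      have : (1 / (1 + s)) • ρ + (s / (1 + s)) • σ = τ := by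
        rw [div_eq_mul_one_div s, mul_comm, ← smul_smul, ← smul_add, ← hP', smul_smul,
          one_div_mul_cancel (by positivity), one_smul]
      rwa [this]

end States

/-! ### Quantum channels -/

/-- A quantum channel (completely positive trace-preserving map) in Kraus form
`X ↦ ∑ i, Kᵢ X Kᵢᴴ`, where `∑ i, Kᵢᴴ Kᵢ = 1`. -/
structure Channel (A B : Type*) [Fintype A] [DecidableEq A] [Fintype B] where
  ι : Type
  [fintypeι : Fintype ι]
  kraus : ι → Matrix B A ℂ
  sum_kraus : ∑ i, (kraus i)ᴴ * kraus i = 1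

attribute [instance] Channel.fintypeι

namespace Channel

variable {A B C D : Type*} [Fintype A] [DecidableEq A] [Fintype B] [Fintype C] [DecidableEq C]
  [Fintype D]

/-- The action of a channel on matrices. -/
def apply (Φ : Channel A B) (X : Matrix A A ℂ) : Matrix B B ℂ :=
  ∑ i, Φ.kraus i * X * (Φ.kraus i)ᴴ

/-- The tensor product of two channels. -/
def tensor (Φ : Channel A B) (Ψ : Channel C D) : Channel (A × C) (B × D) where
  ι := Φ.ι × Ψ.ι
  kraus i := Φ.kraus i.1 ⊗ₖ Ψ.kraus i.2
  sum_kraus := by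
    have h : ∀ i : Φ.ι × Ψ.ι,
        (Φ.kraus i.1 ⊗ₖ Ψ.kraus i.2)ᴴ * (Φ.kraus i.1 ⊗ₖ Ψ.kraus i.2)
          = ((Φ.kraus i.1)ᴴ * Φ.kraus i.1) ⊗ₖ ((Ψ.kraus i.2)ᴴ * Ψ.kraus i.2) := by
      intro i
      rw [Matrix.conjTranspose_kronecker, ← Matrix.mul_kronecker_mul]
    rw [Finset.sum_congr rfl (fun i _ => h i), Fintype.sum_prod_type, ← Matrix.one_kronecker_one,
      ← Φ.sum_kraus, ← Ψ.sum_kraus]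
    ext a b
    simp only [Matrix.sum_apply, Matrix.kroneckerMap_apply, Finset.sum_mul_sum]

end Channel

/-! ### Non-local quantum computations -/

/-- A non-local quantum computation protocol with inputs `A` (left) and `B` (right), outputs `A'`
(left) and `B'` (right), and resource systems `L` (left) and `R` (right). The systems kept (`K`) and
exchanged (`M`) between the two rounds have arbitrary finite dimensions. -/
structure Protocol (A B A' B' L R : Type*) [Fintype A] [DecidableEq A] [Fintype B] [DecidableEq B]
    [Fintype A'] [Fintype B'] [Fintype L] [DecidableEq L] [Fintype R] [DecidableEq R] where
  /-- dimension of the system kept on the left -/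
  ka : ℕ
  /-- dimension of the system kept on the right -/
  kb : ℕ
  /-- dimension of the message received on the left -/
  ma : ℕ
  /-- dimension of the message received on the right -/
  mb : ℕ
  /-- first round operation on the left -/
  VA : Channel (A × L) (Fin ka × Fin mb)
  /-- first round operation on the right -/
  VB : Channel (R × B) (Fin ma × Fin kb)
  /-- second round operation on the left -/
  WA : Channel (Fin ka × Fin ma) A'
  /-- second round operation on the right -/
  WB : Channel (Fin kb × Fin mb) B'

/-- The output of a protocol with resource state `ψ` on the input `X`:
`((W_A ⊗ W_B) ∘ (V_A ⊗ V_B)) (X ⊗ ψ)`, the tensor factors being permuted as required. -/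
def Protocol.run {A B A' B' L R : Type*} [Fintype A] [DecidableEq A] [Fintype B] [DecidableEq B]
    [Fintype A'] [Fintype B'] [Fintype L] [DecidableEq L] [Fintype R] [DecidableEq R]
    (P : Protocol A B A' B' L R) (ψ : Matrix (L × R) (L × R) ℂ) (X : Matrix (A × B) (A × B) ℂ) :
    Matrix (A' × B') (A' × B') ℂ :=
  let input : Matrix ((A × L) × (R × B)) ((A × L) × (R × B)) ℂ :=
    (X ⊗ₖ ψ).submatrix (fun p => ((p.1.1, p.2.2), (p.1.2, p.2.1)))
      (fun p => ((p.1.1, p.2.2), (p.1.2, p.2.1)))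
  let first := (P.VA.tensor P.VB).apply input
  let exchanged : Matrix ((Fin P.ka × Fin P.ma) × (Fin P.kb × Fin P.mb))
      ((Fin P.ka × Fin P.ma) × (Fin P.kb × Fin P.mb)) ℂ :=
    first.submatrix (fun p => ((p.1.1, p.2.2), (p.1.2, p.2.1)))
      (fun p => ((p.1.1, p.2.2), (p.1.2, p.2.1)))
  (P.WA.tensor P.WB).apply exchanged

/-! ### The BB84 measurement task -/

/-- The computational basis index set of `n` qubits; also the set of bit strings of length `n`. -/
abbrev Bits (n : ℕ) : Type := Fin n → Fin 2

/-- The Hadamard matrix. -/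
def hadamard : Matrix (Fin 2) (Fin 2) ℂ :=
  ((Real.sqrt 2 : ℝ) : ℂ)⁻¹ • !![1, 1; 1, -1]

/-- The single-qubit BB84 vector `H^q |b⟩`. -/
def bb84Vec (q b : Fin 2) : Fin 2 → ℂ :=
  (hadamard ^ (q : ℕ)) *ᵥ Pi.single b 1

/-- The `n`-qubit vector `⊗ᵢ H^{θᵢ} |xᵢ⟩`. -/
def bb84VecN {n : ℕ} (θ x : Bits n) : Bits n → ℂ :=
  fun a => ∏ i, bb84Vec (θ i) (x i) (a i)

/-- The rank-one operator `|v⟩⟨v|`. -/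
def ketbra {A : Type*} (v : A → ℂ) : Matrix A A ℂ :=
  Matrix.vecMulVec v (star v)

/-- The input of the `n`-fold BB84 measurement task: the qubits `⊗ᵢ H^{θᵢ} |xᵢ⟩` on the left and the
classical string `θ` (as a computational basis state) on the right. -/
def bb84Input {n : ℕ} (θ x : Bits n) : Matrix (Bits n × Bits n) (Bits n × Bits n) ℂ :=
  ketbra (bb84VecN θ x) ⊗ₖ ketbra (Pi.single θ 1)

/-- Protocols for the `n`-fold BB84 measurement task. Both outputs are `n`-bit registers, read out
in the computational basis. -/
abbrev BB84Protocol (n : ℕ) (L R : Type*) [Fintype L] [DecidableEq L] [Fintype R]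
    [DecidableEq R] :=
  Protocol (Bits n) (Bits n) (Bits n) (Bits n) L R

/-- The number of failed rounds when the correct string is `x` and the outputs are `y` (left) and
`z` (right): a round succeeds when both outputs are correct. -/
def failedRounds {n : ℕ} (x y z : Bits n) : ℕ :=
  (Finset.univ.filter fun i => ¬ (y i = x i ∧ z i = x i)).card

/-- The probability that the protocol, run with resource state `ρ` on the input labelled by `θ` and
`x`, outputs `y` on the left and `z` on the right. -/
def outputProb {n : ℕ} {L R : Type*} [Fintype L] [DecidableEq L] [Fintype R] [DecidableEq R]
    (P : BB84Protocol n L R) (ρ : Matrix (L × R) (L × R) ℂ) (θ x y z : Bits n) : ℝ :=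
  (P.run ρ (bb84Input θ x) (y, z) (y, z)).re

open Classical in
/-- The success probability of a protocol with resource state `ρ` in the `n`-fold,
`(1-δ)`-threshold BB84 measurement task: `θ` and `x` are uniformly random bit strings, and the
protocol succeeds when at most `δ n` rounds fail. -/
def successProb {n : ℕ} {L R : Type*} [Fintype L] [DecidableEq L] [Fintype R] [DecidableEq R]
    (δ : ℝ) (P : BB84Protocol n L R) (ρ : Matrix (L × R) (L × R) ℂ) : ℝ :=
  (∑ θ : Bits n, ∑ x : Bits n, ∑ y : Bits n, ∑ z : Bits n,
    if (failedRounds x y z : ℝ) ≤ δ * n then outputProb P ρ θ x y z else 0) / (2 ^ n * 2 ^ n)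

/-- The binary entropy function in bits: `h(p) = - p log₂ p - (1 - p) log₂ (1 - p)`. -/
def binEntropyBits (p : ℝ) : ℝ :=
  Real.binEntropy p / Real.log 2

end NLQC

end

noncomputable section

namespace NLQC

/-! ### Operator norms of matrices and a Schur test -/

section OperatorNorm

set_option linter.unusedSectionVars false

open scoped Matrix.Norms.L2Operator

/-! The success probability is linear in the resource, so everything reduces to bounding it by `B ^
n`, with `B = 2^{h(δ)} β`, for product resources. Convexity extends the bound to separable ones. If
`ρ` mixed with `s` parts of a separable `σ` is separable, then dropping the nonnegative contribution
of `σ` gives success at most `(1 + s) B ^ n` for `ρ`; the infimum over `s` and a logarithm finish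
the proof.

For a product resource the task becomes a monogamy-of-entanglement game. Replace the random BB84
input by halves of unnormalised EPR pairs whose reference halves are measured in basis `θ` with
outcome `x`. Alice's first operation then yields vectors `ψ` on reference, `K_a` and `M_b` that do
not depend on `θ`. Bob's operation yields vectors `b θ` on `M_a` and `K_b`, which depend on `θ` but
are independent of `x`. They may be entangled across the two sides; still, seen from one side alone,
`b θ` is only an ancilla of a measurement of `K_a` (left) or of `M_b` (right).

Fix a set `S` of rounds and let `T θ` be the operator of winning on `S` in basis `θ`. It is
dominated both by a left-only and by a right-only operator, so `‖T θ * (T θ')ᴴ‖` is at most the norm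
of a left operator for `θ` times the adjoint of a right operator for `θ'`. These two meet only on
the reference qubits, where conjugate bases contribute a factor `1/√2` for each `i ∈ S` with `θ i ≠
θ' i`. The Schur test `sum_norm_mulVec_sq_le` and `(1 + 1/√2)/2 = β` show that winning on `S` has
probability at most `β ^ |S|` (`sum_outputProb_agree_le`).

Failures are then allowed through a Chernoff-type argument: weighting each `S` by `t ^ |S|` gives
`successProb_mul_rpow_le`, and `1 + t = (1 - δ)/δ` produces the entropy factor. -/

theorem norm_toLp_sq {A : Type*} [Fintype A] (f : A → ℂ) : ‖WithLp.toLp 2 f‖ ^ 2 = ∑ i, ‖f i‖ ^ 2 := by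
  rw [EuclideanSpace.norm_sq_eq]

variable {A B B' X Y : Type*} [Fintype A] [DecidableEq A] [Fintype B] [DecidableEq B] [Fintype B']
  [DecidableEq B'] [Fintype X] [DecidableEq X] [Fintype Y] [DecidableEq Y]

theorem norm_mulVec_le (M : Matrix B A ℂ) (v : A → ℂ) :
    ‖WithLp.toLp 2 (M *ᵥ v)‖ ≤ ‖M‖ * ‖WithLp.toLp 2 v‖ :=
  Matrix.l2_opNorm_mulVec M (WithLp.toLp 2 v)

theorem opNorm_le_of_mulVec (M : Matrix B A ℂ) {c : ℝ} (hc : 0 ≤ c)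
    (h : ∀ v : A → ℂ, ‖WithLp.toLp 2 (M *ᵥ v)‖ ≤ c * ‖WithLp.toLp 2 v‖) : ‖M‖ ≤ c := by
  rw [Matrix.l2_opNorm_def]
  exact ContinuousLinearMap.opNorm_le_bound _ hc fun v => h v.ofLp

theorem inner_toLp (f g : A → ℂ) :
    inner ℂ (WithLp.toLp 2 f) (WithLp.toLp 2 g) = star f ⬝ᵥ g := by
  rw [EuclideanSpace.inner_toLp_toLp, dotProduct_comm]

theorem norm_star_dotProduct_le (f g : A → ℂ) :
    ‖star f ⬝ᵥ g‖ ≤ ‖WithLp.toLp 2 f‖ * ‖WithLp.toLp 2 g‖ := by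
  rw [← inner_toLp]
  exact norm_inner_le_norm _ _

theorem star_dotProduct_self (f : A → ℂ) :
    star f ⬝ᵥ f = ((‖WithLp.toLp 2 f‖ ^ 2 : ℝ) : ℂ) := by
  rw [← inner_toLp, inner_self_eq_norm_sq_to_K]
  push_cast
  rfl

theorem norm_star_dotProduct_self (f : A → ℂ) : ‖star f ⬝ᵥ f‖ = ‖WithLp.toLp 2 f‖ ^ 2 := by
  rw [star_dotProduct_self, Complex.norm_real, Real.norm_of_nonneg (by positivity)]

theorem opNorm_le_of_dotProduct (M : Matrix B A ℂ) {c : ℝ} (hc : 0 ≤ c)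
    (h : ∀ (f : B → ℂ) (g : A → ℂ),
      ‖star f ⬝ᵥ (M *ᵥ g)‖ ≤ c * (‖WithLp.toLp 2 f‖ * ‖WithLp.toLp 2 g‖)) : ‖M‖ ≤ c := by
  refine opNorm_le_of_mulVec M hc fun v => ?_
  have h1 := h (M *ᵥ v) v
  rw [norm_star_dotProduct_self] at h1
  rcases (norm_nonneg (WithLp.toLp 2 (M *ᵥ v))).eq_or_lt with h0 | h0
  · rw [← h0]; positivity
  · refine le_of_mul_le_mul_left ?_ h0
    nlinarith

theorem opNorm_mul_le_of_mulVec_le (T : Matrix B A ℂ) (R : Matrix B' A ℂ) (M : Matrix A X ℂ)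
    (h : ∀ v : A → ℂ, ‖WithLp.toLp 2 (T *ᵥ v)‖ ≤ ‖WithLp.toLp 2 (R *ᵥ v)‖) :
    ‖T * M‖ ≤ ‖R * M‖ := by
  refine opNorm_le_of_mulVec _ (norm_nonneg _) fun v => ?_
  have h1 := h (M *ᵥ v)
  rw [Matrix.mulVec_mulVec, Matrix.mulVec_mulVec] at h1
  exact h1.trans (norm_mulVec_le _ _)

/-- Domination replaces the left factor, and taking adjoints brings the other factor to the left.
Two different dominating operators may thus be used, which later lets one basis be seen from the
left player and the other from the right player. -/
theorem opNorm_mul_conjTranspose_le (T : Matrix B A ℂ) (T' : Matrix B' A ℂ) (R : Matrix X A ℂ)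
    (R' : Matrix Y A ℂ)
    (h : ∀ v : A → ℂ, ‖WithLp.toLp 2 (T *ᵥ v)‖ ≤ ‖WithLp.toLp 2 (R *ᵥ v)‖)
    (h' : ∀ v : A → ℂ, ‖WithLp.toLp 2 (T' *ᵥ v)‖ ≤ ‖WithLp.toLp 2 (R' *ᵥ v)‖) :
    ‖T * T'ᴴ‖ ≤ ‖R * R'ᴴ‖ := by
  have swap' : ‖R * T'ᴴ‖ = ‖T' * Rᴴ‖ := by
    rw [← Matrix.l2_opNorm_conjTranspose, Matrix.conjTranspose_mul,
      Matrix.conjTranspose_conjTranspose]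
  have swap'' : ‖R * R'ᴴ‖ = ‖R' * Rᴴ‖ := by
    rw [← Matrix.l2_opNorm_conjTranspose, Matrix.conjTranspose_mul,
      Matrix.conjTranspose_conjTranspose]
  calc ‖T * T'ᴴ‖ ≤ ‖R * T'ᴴ‖ := opNorm_mul_le_of_mulVec_le _ _ _ h
    _ = ‖T' * Rᴴ‖ := swap'
    _ ≤ ‖R' * Rᴴ‖ := opNorm_mul_le_of_mulVec_le _ _ _ h'
    _ = ‖R * R'ᴴ‖ := swap''.symm

/-- Schur test: if the operators `T θ * (T θ')ᴴ` are bounded by a symmetric matrix with row sums at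
most `C`, then `∑ θ, (T θ)ᴴ * T θ` is bounded by `C`. -/
theorem sum_norm_mulVec_sq_le {Θ : Type*} [Fintype Θ] [Nonempty Θ] (T : Θ → Matrix B A ℂ) (c : Θ → Θ → ℝ)
    (hc : ∀ θ θ', ‖T θ * (T θ')ᴴ‖ ≤ c θ θ') (hsymm : ∀ θ θ', c θ θ' = c θ' θ) (C : ℝ)
    (hC : ∀ θ, ∑ θ', c θ θ' ≤ C) (v : A → ℂ) :
    ∑ θ, ‖WithLp.toLp 2 (T θ *ᵥ v)‖ ^ 2 ≤ C * ‖WithLp.toLp 2 v‖ ^ 2 := by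
  -- Duality: with `u = ∑ (T θ)ᴴ T θ v` the sum `s` equals `⟨v, u⟩`, so `s ≤ ‖v‖ ‖u‖`. Expanding
  -- `‖u‖²` involves only the products `T θ (T θ')ᴴ` and gives `‖u‖² ≤ C s`; one factor `s` then
  -- cancels.
  set w : Θ → B → ℂ := fun θ => T θ *ᵥ v with hw
  set u : A → ℂ := ∑ θ, (T θ)ᴴ *ᵥ w θ with hu
  set s : ℝ := ∑ θ, ‖WithLp.toLp 2 (w θ)‖ ^ 2 with hs
  have hs0 : 0 ≤ s := Finset.sum_nonneg fun _ _ => by positivity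
  have h1 : star v ⬝ᵥ u = (s : ℂ) := by
    rw [hu, dotProduct_sum, hs]
    push_cast
    refine Finset.sum_congr rfl fun θ _ => ?_
    rw [Matrix.dotProduct_mulVec, ← Matrix.star_mulVec]
    rw [star_dotProduct_self]
    push_cast
    rfl
  have h2 : s ≤ ‖WithLp.toLp 2 v‖ * ‖WithLp.toLp 2 u‖ := by
    have := norm_star_dotProduct_le v u
    rwa [h1, Complex.norm_real, Real.norm_of_nonneg hs0] at this
  have h3 : star u ⬝ᵥ u = ∑ θ, ∑ θ', star (w θ) ⬝ᵥ ((T θ * (T θ')ᴴ) *ᵥ w θ') := by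
    conv_lhs => rw [hu]
    rw [star_sum, sum_dotProduct]
    refine Finset.sum_congr rfl fun θ _ => ?_
    rw [dotProduct_sum]
    refine Finset.sum_congr rfl fun θ' _ => ?_
    rw [Matrix.star_mulVec, Matrix.conjTranspose_conjTranspose, ← Matrix.dotProduct_mulVec,
      Matrix.mulVec_mulVec]
  have h4 : ‖WithLp.toLp 2 u‖ ^ 2 ≤ C * s := by
    rw [← norm_star_dotProduct_self, h3]
    calc ‖∑ θ, ∑ θ', star (w θ) ⬝ᵥ ((T θ * (T θ')ᴴ) *ᵥ w θ')‖
        ≤ ∑ θ, ∑ θ', c θ θ' * (‖WithLp.toLp 2 (w θ)‖ * ‖WithLp.toLp 2 (w θ')‖) := by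
          refine (norm_sum_le _ _).trans (Finset.sum_le_sum fun θ _ =>
            (norm_sum_le _ _).trans (Finset.sum_le_sum fun θ' _ => ?_))
          refine (norm_star_dotProduct_le _ _).trans ?_
          have := (norm_mulVec_le (T θ * (T θ')ᴴ) (w θ')).trans
            (mul_le_mul_of_nonneg_right (hc θ θ') (norm_nonneg _))
          nlinarith [mul_le_mul_of_nonneg_left this (norm_nonneg (WithLp.toLp 2 (w θ)))]
      _ ≤ ∑ θ, ∑ θ', (c θ θ' * ‖WithLp.toLp 2 (w θ)‖ ^ 2 / 2
            + c θ' θ * ‖WithLp.toLp 2 (w θ')‖ ^ 2 / 2) := by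
          -- Here `2ab ≤ a² + b²`; by symmetry of `c` the second half is written with `c θ' θ`, so
          -- that exchanging the sums turns both halves into row sums.
          refine Finset.sum_le_sum fun θ _ => Finset.sum_le_sum fun θ' _ => ?_
          rw [hsymm θ' θ]
          have h0 : 0 ≤ c θ θ' := (norm_nonneg _).trans (hc θ θ')
          nlinarith [mul_nonneg h0 (sq_nonneg
            (‖WithLp.toLp 2 (w θ)‖ - ‖WithLp.toLp 2 (w θ')‖))]
      _ = ∑ θ, (∑ θ', c θ θ') * ‖WithLp.toLp 2 (w θ)‖ ^ 2 := by
          simp only [Finset.sum_add_distrib]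
          rw [Finset.sum_comm (f := fun θ θ' => c θ' θ * ‖WithLp.toLp 2 (w θ')‖ ^ 2 / 2)]
          rw [← Finset.sum_add_distrib]
          refine Finset.sum_congr rfl fun θ _ => ?_
          rw [← Finset.sum_add_distrib, Finset.sum_mul]
          exact Finset.sum_congr rfl fun θ' _ => by ring
      _ ≤ C * s := by
          rw [hs, Finset.mul_sum]
          exact Finset.sum_le_sum fun θ _ => mul_le_mul_of_nonneg_right (hC θ) (by positivity)
  rcases hs0.eq_or_lt with h0 | h0
  · rw [← h0]
    have hC0 : 0 ≤ C := (Finset.sum_nonneg fun θ' _ => (norm_nonneg _).trans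
      (hc (Classical.arbitrary Θ) θ')).trans (hC _)
    positivity
  · have h5 : s ^ 2 ≤ ‖WithLp.toLp 2 v‖ ^ 2 * ‖WithLp.toLp 2 u‖ ^ 2 := by
      rw [← mul_pow]
      exact pow_le_pow_left₀ hs0 h2 2
    refine le_of_mul_le_mul_left ?_ h0
    nlinarith [mul_le_mul_of_nonneg_left h4 (sq_nonneg ‖WithLp.toLp 2 v‖)]

end OperatorNorm

/-! ### Overlaps of BB84 states -/

section Overlap

/-- The overlap `⟨H^q' b' | H^q b⟩` of two BB84 vectors. -/
def overlap (q q' b b' : Fin 2) : ℂ :=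
  ∑ a, bb84Vec q b a * star (bb84Vec q' b' a)

theorem bb84Vec_zero (b a : Fin 2) : bb84Vec 0 b a = if a = b then 1 else 0 := by
  fin_cases a <;> fin_cases b <;> simp [bb84Vec]

theorem bb84Vec_one (b a : Fin 2) :
    bb84Vec 1 b a = ((√2 : ℝ) : ℂ)⁻¹ * (if a = 1 ∧ b = 1 then -1 else 1) := by
  fin_cases a <;> fin_cases b <;> simp [bb84Vec, hadamard, Matrix.mulVec]

theorem inv_sqrt_two_mul_self : ((√2 : ℝ) : ℂ)⁻¹ * ((√2 : ℝ) : ℂ)⁻¹ = 1 / 2 := by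
  rw [← mul_inv, ← Complex.ofReal_mul, Real.mul_self_sqrt (by norm_num)]
  norm_num

theorem star_bb84Vec (q b a : Fin 2) : star (bb84Vec q b a) = bb84Vec q b a := by
  fin_cases q
  · simp only [Fin.zero_eta, bb84Vec_zero]; split_ifs <;> simp
  · simp only [Fin.mk_one, bb84Vec_one]; split_ifs <;> simp [Complex.conj_ofReal]

/-- Both families of BB84 vectors are orthonormal bases. -/
theorem sum_bb84Vec_mul (q b b' : Fin 2) :
    ∑ a, bb84Vec q b a * bb84Vec q b' a = if b = b' then 1 else 0 := by
  have h := inv_sqrt_two_mul_self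
  fin_cases q
  · fin_cases b <;> fin_cases b' <;> simp [bb84Vec_zero]
  · fin_cases b <;> fin_cases b' <;> (simp [bb84Vec_one, h]; try norm_num)

/-- Symmetry of `H^q` turns orthonormality of the basis vectors into the completeness relation
needed for `sum_star_overlap_mul`. -/
theorem bb84Vec_comm (q b a : Fin 2) : bb84Vec q b a = bb84Vec q a b := by
  fin_cases q
  · simp [bb84Vec_zero, eq_comm]
  · simp [bb84Vec_one, and_comm]

/-- The bound on the modulus of overlaps. -/
def overlapBound (q q' : Fin 2) : ℝ := if q = q' then 1 else (√2)⁻¹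

theorem overlapBound_nonneg (q q' : Fin 2) : 0 ≤ overlapBound q q' := by
  unfold overlapBound; split_ifs <;> positivity

theorem norm_overlap_le (q q' b b' : Fin 2) : ‖overlap q q' b b'‖ ≤ overlapBound q q' := by
  simp only [overlap, star_bb84Vec]
  by_cases hq : q = q'
  · subst hq
    rw [sum_bb84Vec_mul]
    simp only [overlapBound, if_true]
    split_ifs <;> simp
  · simp only [overlapBound, if_neg hq]
    fin_cases q <;> fin_cases q' <;>
      first
      | exact absurd rfl hq
      | fin_cases b <;> fin_cases b' <;> simp [bb84Vec_zero, bb84Vec_one, abs_of_nonneg]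

/-- The overlaps form the change of basis between two orthonormal bases, hence a unitary matrix.
This is why positions outside `S` cost only a factor `1`. -/
theorem sum_star_overlap_mul (q q' b b' : Fin 2) :
    ∑ x, star (overlap q q' x b) * overlap q q' x b' = if b = b' then 1 else 0 := by
  have e : ∀ x b, overlap q q' x b = ∑ a, bb84Vec q x a * bb84Vec q' b a := fun x b => by
    simp only [overlap, star_bb84Vec]
  have e' : ∀ x b, star (overlap q q' x b) = ∑ a, bb84Vec q x a * bb84Vec q' b a := fun x b => by
    rw [e, star_sum]; simp only [star_mul', star_bb84Vec]
  rw [Finset.sum_congr rfl fun x _ => by rw [e', e]]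
  calc ∑ x, (∑ a, bb84Vec q x a * bb84Vec q' b a) * ∑ a, bb84Vec q x a * bb84Vec q' b' a
      = ∑ a, ∑ a', (∑ x, bb84Vec q a x * bb84Vec q a' x)
          * (bb84Vec q' b a * bb84Vec q' b' a') := by
        simp only [Fin.sum_univ_two, bb84Vec_comm q 0 1]
        ring
    _ = if b = b' then 1 else 0 := by
        simp only [sum_bb84Vec_mul, ite_mul, one_mul, zero_mul, Finset.sum_ite_eq,
          Finset.mem_univ, if_true]

/-! ### Overlap matrices restricted to agreement on a set of positions -/

variable {n : ℕ}

/-- Agreement of two bit strings on a set of positions. -/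
abbrev AgreeOn (S : Finset (Fin n)) (x y : Bits n) : Prop := ∀ i ∈ S, x i = y i

/-- The single-position factor of the restricted overlap matrix. -/
def restrictedFactor (S : Finset (Fin n)) (θ θ' y z : Bits n) (i : Fin n) (a b : Fin 2) : ℂ :=
  if i ∈ S then (if a = y i ∧ b = z i then overlap (θ i) (θ' i) a b else 0)
  else overlap (θ i) (θ' i) a b

/-- The matrix of overlaps of the strings that agree with `y` and `z` on `S`. -/
def restrictedOverlap (S : Finset (Fin n)) (θ θ' y z : Bits n) : Matrix (Bits n) (Bits n) ℂ :=
  fun x x' => if AgreeOn S x y ∧ AgreeOn S x' z then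
    ∑ a, bb84VecN θ x a * star (bb84VecN θ' x' a) else 0

theorem sum_bb84VecN_mul_star (θ θ' x x' : Bits n) :
    ∑ a, bb84VecN θ x a * star (bb84VecN θ' x' a) = ∏ i, overlap (θ i) (θ' i) (x i) (x' i) := by
  simp only [bb84VecN, overlap, star_prod, ← Finset.prod_mul_distrib]
  rw [Finset.prod_univ_sum]
  simp

/-- Both the inner product and the agreement condition split over positions, so the matrix is a
tensor product of 2 × 2 factors. -/
theorem restrictedOverlap_eq_prod (S : Finset (Fin n)) (θ θ' y z x x' : Bits n) :
    restrictedOverlap S θ θ' y z x x' = ∏ i, restrictedFactor S θ θ' y z i (x i) (x' i) := by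
  unfold restrictedOverlap
  split_ifs with h
  · rw [sum_bb84VecN_mul_star]
    refine Finset.prod_congr rfl fun i _ => ?_
    unfold restrictedFactor
    split_ifs with h1 h2
    · rfl
    · exact absurd ⟨h.1 i h1, h.2 i h1⟩ h2
    · rfl
  · have : ∃ i ∈ S, ¬ (x i = y i ∧ x' i = z i) := by
      by_contra! hc
      exact h ⟨fun i hi => (hc i hi).1, fun i hi => (hc i hi).2⟩
    obtain ⟨i, hi, hne⟩ := this
    refine (Finset.prod_eq_zero (Finset.mem_univ i) ?_).symm
    simp only [restrictedFactor, if_pos hi, if_neg hne]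

/-- The bound on the norm of the restricted overlap matrix. -/
def overlapBoundOn (S : Finset (Fin n)) (θ θ' : Bits n) : ℝ :=
  ∏ i, if i ∈ S then overlapBound (θ i) (θ' i) else 1

theorem overlapBoundOn_nonneg (S : Finset (Fin n)) (θ θ' : Bits n) :
    0 ≤ overlapBoundOn S θ θ' :=
  Finset.prod_nonneg fun i _ => by split_ifs; exacts [overlapBound_nonneg _ _, zero_le_one]

theorem overlapBoundOn_comm (S : Finset (Fin n)) (θ θ' : Bits n) :
    overlapBoundOn S θ θ' = overlapBoundOn S θ' θ := by
  simp only [overlapBoundOn, overlapBound, eq_comm]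

/-- Each factor has orthogonal columns: for `i ∈ S` it has at most one nonzero entry, an overlap,
and otherwise it is unitary. -/
theorem sum_star_restrictedFactor_mul (S : Finset (Fin n)) (θ θ' y z : Bits n) (i : Fin n)
    (b b' : Fin 2) :
    (b ≠ b' → ∑ x, star (restrictedFactor S θ θ' y z i x b) * restrictedFactor S θ θ' y z i x b'
      = 0) ∧
    ‖∑ x, star (restrictedFactor S θ θ' y z i x b) * restrictedFactor S θ θ' y z i x b‖
      ≤ (if i ∈ S then overlapBound (θ i) (θ' i) else 1) ^ 2 := by
  unfold restrictedFactor
  by_cases hi : i ∈ S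
  · simp only [if_pos hi]
    constructor
    · intro hb
      refine Finset.sum_eq_zero fun x _ => ?_
      split_ifs with h1 h2
      · exact absurd (h1.2.trans h2.2.symm) hb
      all_goals simp
    · rw [Finset.sum_eq_single (y i)]
      · split_ifs with h
        · rw [norm_mul, norm_star, ← sq]
          exact pow_le_pow_left₀ (norm_nonneg _) (norm_overlap_le _ _ _ _) 2
        · simp; positivity
      · intro x _ hx
        simp [hx]
      · simp
  · simp only [if_neg hi, sum_star_overlap_mul]
    exact ⟨fun hb => if_neg hb, by simp⟩

open scoped Matrix.Norms.L2Operator in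
theorem norm_restrictedOverlap_le (S : Finset (Fin n)) (θ θ' y z : Bits n) :
    ‖restrictedOverlap S θ θ' y z‖ ≤ overlapBoundOn S θ θ' := by
  set D := restrictedOverlap S θ θ' y z with hD
  have hent : ∀ b b', (Dᴴ * D) b b' = ∏ i, ∑ x,
      star (restrictedFactor S θ θ' y z i x (b i)) * restrictedFactor S θ θ' y z i x (b' i) := by
    intro b b'
    rw [Finset.prod_univ_sum, Matrix.mul_apply]
    simp only [Matrix.conjTranspose_apply, hD, restrictedOverlap_eq_prod, star_prod,
      Finset.prod_mul_distrib, Fintype.piFinset_univ]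
  -- Orthogonality of the columns at a single position where `b` and `b'` differ suffices. The
  -- C*-identity then reads `‖D‖²` off the diagonal.
  have hdiag : Dᴴ * D = Matrix.diagonal fun b => (Dᴴ * D) b b := by
    ext b b'
    by_cases hb : b = b'
    · subst hb; simp
    · rw [Matrix.diagonal_apply_ne _ hb, hent]
      obtain ⟨i, hi⟩ := Function.ne_iff.1 hb
      exact Finset.prod_eq_zero (Finset.mem_univ i)
        ((sum_star_restrictedFactor_mul S θ θ' y z i _ _).1 hi)
  have h0 := overlapBoundOn_nonneg S θ θ'
  have h1 : ‖D‖ * ‖D‖ ≤ overlapBoundOn S θ θ' ^ 2 := by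
    rw [← Matrix.l2_opNorm_conjTranspose_mul_self, hdiag, Matrix.l2_opNorm_diagonal,
      pi_norm_le_iff_of_nonneg (by positivity)]
    intro b
    rw [hent, norm_prod, overlapBoundOn, ← Finset.prod_pow]
    exact Finset.prod_le_prod (fun _ _ => norm_nonneg _) fun i _ =>
      (sum_star_restrictedFactor_mul S θ θ' y z i _ (b i)).2
  rw [← sq] at h1
  exact le_of_sq_le_sq h1 h0

theorem cos_sq_pi_div_eight : Real.cos (Real.pi / 8) ^ 2 = (1 + (√2)⁻¹) / 2 := by
  rw [Real.cos_sq, show 2 * (Real.pi / 8) = Real.pi / 4 by ring, Real.cos_pi_div_four]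
  have : (√2)⁻¹ = √2 / 2 := by
    rw [inv_eq_iff_eq_inv, inv_div, eq_div_iff (by positivity), Real.mul_self_sqrt (by norm_num)]
  rw [this]; ring

/-- The sum factorises over positions: `1 + 1/√2 = 2β` for each position in `S`, and `1 + 1 = 2` for
each other one. -/
theorem sum_overlapBoundOn (S : Finset (Fin n)) (θ : Bits n) :
    ∑ θ', overlapBoundOn S θ θ' = 2 ^ n * (Real.cos (Real.pi / 8) ^ 2) ^ S.card := by
  have h : ∀ i, ∑ q, (if i ∈ S then overlapBound (θ i) q else 1)
      = 2 * (if i ∈ S then Real.cos (Real.pi / 8) ^ 2 else 1) := by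
    intro i
    split_ifs with hi
    · rw [cos_sq_pi_div_eight]
      generalize θ i = q
      fin_cases q <;> simp [overlapBound] <;> ring
    · simp
  unfold overlapBoundOn
  have := Finset.prod_univ_sum (fun _ : Fin n => (Finset.univ : Finset (Fin 2)))
    (fun i q => if i ∈ S then overlapBound (θ i) q else 1)
  rw [Fintype.piFinset_univ] at this
  rw [← this, Finset.prod_congr rfl (fun i _ => h i), Finset.prod_mul_distrib, Finset.prod_ite]
  simp

end Overlap

/-! ### Output probabilities as squared amplitudes -/

theorem ketbra_apply {A : Type*} (v : A → ℂ) (a a' : A) : ketbra v a a' = v a * star (v a') := rfl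

theorem ketbra_apply_self {A : Type*} (v : A → ℂ) (a : A) :
    ketbra v a a = ((‖v a‖ ^ 2 : ℝ) : ℂ) := by
  rw [ketbra_apply]
  push_cast
  exact Complex.mul_conj' (v a)

theorem mul_ketbra_mul {A B : Type*} [Fintype A] (M : Matrix B A ℂ) (v : A → ℂ) :
    M * ketbra v * Mᴴ = ketbra (M *ᵥ v) := by
  rw [ketbra, ketbra, Matrix.mul_vecMulVec, Matrix.vecMulVec_mul, Matrix.star_mulVec]

theorem ketbra_submatrix {A B : Type*} (v : A → ℂ) (f : B → A) :
    (ketbra v).submatrix f f = ketbra (v ∘ f) := rfl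

theorem ketbra_kronecker {A B : Type*} (v : A → ℂ) (w : B → ℂ) :
    ketbra v ⊗ₖ ketbra w = ketbra fun p => v p.1 * w p.2 := by
  ext i j
  simp only [Matrix.kroneckerMap_apply, ketbra_apply, star_mul']
  ring

open scoped MatrixOrder Matrix.Norms.L2Operator in
theorem posSemidef_eq_sum_ketbra {A : Type*} [Fintype A] [DecidableEq A] {M : Matrix A A ℂ}
    (hM : M.PosSemidef) : ∃ c : A → A → ℂ, M = ∑ l, ketbra (c l) := by
  obtain ⟨B, rfl⟩ := CStarAlgebra.nonneg_iff_eq_star_mul_self.1 hM.nonneg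
  refine ⟨fun l a => star (B l a), ?_⟩
  ext a a'
  simp [Matrix.mul_apply, Matrix.sum_apply, ketbra_apply]

theorem kronecker_mulVec_mul {A B C D : Type*} [Fintype A] [Fintype C] (M : Matrix B A ℂ)
    (N : Matrix D C ℂ) (v : A → ℂ) (w : C → ℂ) :
    (M ⊗ₖ N) *ᵥ (fun p => v p.1 * w p.2) = fun p => (M *ᵥ v) p.1 * (N *ᵥ w) p.2 := by
  ext p
  simp only [Matrix.mulVec, dotProduct, Matrix.kroneckerMap_apply, Fintype.sum_prod_type,
    Finset.sum_mul_sum]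
  exact Finset.sum_congr rfl fun i _ => Finset.sum_congr rfl fun j _ => by ring

theorem star_dotProduct_eq_sum {A : Type*} [Fintype A] (w : A → ℂ) :
    star w ⬝ᵥ w = ((∑ c, ‖w c‖ ^ 2 : ℝ) : ℂ) := by
  simp only [dotProduct, Pi.star_apply]
  push_cast
  exact Finset.sum_congr rfl fun c _ => Complex.conj_mul' (w c)

theorem submatrix_sum {s C D : Type*} [Fintype s] (X : s → Matrix C C ℂ) (f : D → C) :
    (∑ i, X i).submatrix f f = ∑ i, (X i).submatrix f f := by
  ext a b
  simp [Matrix.sum_apply]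

namespace Channel

variable {A B : Type*} [Fintype A] [DecidableEq A] [Fintype B]

theorem apply_add (Φ : Channel A B) (X Y : Matrix A A ℂ) :
    Φ.apply (X + Y) = Φ.apply X + Φ.apply Y := by
  simp only [apply, Matrix.mul_add, Matrix.add_mul, Finset.sum_add_distrib]

theorem apply_smul (Φ : Channel A B) (r : ℂ) (X : Matrix A A ℂ) :
    Φ.apply (r • X) = r • Φ.apply X := by
  simp only [apply, Matrix.mul_smul, Matrix.smul_mul, Finset.smul_sum]

theorem apply_ketbra (Φ : Channel A B) (v : A → ℂ) :
    Φ.apply (ketbra v) = ∑ i, ketbra (Φ.kraus i *ᵥ v) := by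
  simp only [apply, mul_ketbra_mul]

theorem apply_sum {s : Type*} (t : Finset s) (Φ : Channel A B) (X : s → Matrix A A ℂ) :
    Φ.apply (∑ i ∈ t, X i) = ∑ i ∈ t, Φ.apply (X i) := by
  simp only [apply, Matrix.mul_sum, Matrix.sum_mul]
  exact Finset.sum_comm

theorem tensor_apply_ketbra {C D : Type*} [Fintype C] [DecidableEq C] [Fintype D]
    (Φ : Channel A B) (Ψ : Channel C D) (v : A × C → ℂ) :
    (Φ.tensor Ψ).apply (ketbra v)
      = ∑ i, ∑ j, ketbra ((Φ.kraus i ⊗ₖ Ψ.kraus j) *ᵥ v) :=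
  (apply_ketbra _ _).trans
    (Fintype.sum_prod_type fun i : Φ.ι × Ψ.ι => ketbra ((Φ.kraus i.1 ⊗ₖ Ψ.kraus i.2) *ᵥ v))

/-- The Kraus operators of a channel form an isometry. -/
theorem sum_norm_mulVec_sq (Φ : Channel A B) (v : A → ℂ) :
    ∑ i, ∑ b, ‖(Φ.kraus i *ᵥ v) b‖ ^ 2 = ∑ a, ‖v a‖ ^ 2 := by
  have h2 : ∑ i, star (Φ.kraus i *ᵥ v) ⬝ᵥ (Φ.kraus i *ᵥ v) = star v ⬝ᵥ v := by
    simp only [Matrix.star_mulVec, ← Matrix.dotProduct_mulVec, Matrix.mulVec_mulVec]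
    rw [← dotProduct_sum, ← Matrix.sum_mulVec, Φ.sum_kraus, Matrix.one_mulVec]
  simp only [star_dotProduct_eq_sum] at h2
  exact_mod_cast h2

end Channel

section Run

variable {A B A' B' L R : Type*} [Fintype A] [DecidableEq A] [Fintype B] [DecidableEq B]
    [Fintype A'] [Fintype B'] [Fintype L] [DecidableEq L] [Fintype R] [DecidableEq R]

/-- The output of a protocol as a linear function of the resource state. -/
def Protocol.runLinear (P : Protocol A B A' B' L R) (X : Matrix (A × B) (A × B) ℂ) :
    Matrix (L × R) (L × R) ℂ →ₗ[ℂ] Matrix (A' × B') (A' × B') ℂ where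
  toFun ψ := P.run ψ X
  map_add' ψ χ := by
    simp only [Protocol.run, Matrix.kronecker_add, Matrix.submatrix_add, Channel.apply_add,
      Pi.add_apply]
  map_smul' r ψ := by
    simp only [Protocol.run, Matrix.kronecker_smul, Matrix.submatrix_smul, Channel.apply_smul,
      Pi.smul_apply, RingHom.id_apply]

/-- The amplitude of the outcomes `y` and `z` after the second round, on a product of a left vector
`a` and a right vector `b`. -/
def Protocol.amplitude (P : Protocol A B A' B' L R) (u : P.WA.ι) (v : P.WB.ι) (y : A') (z : B')
    (a : Fin P.ka × Fin P.mb → ℂ) (b : Fin P.ma × Fin P.kb → ℂ) : ℂ :=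
  ∑ p : Fin P.ka × Fin P.ma, ∑ q : Fin P.kb × Fin P.mb,
    P.WA.kraus u y p * P.WB.kraus v z q * (a (p.1, q.2) * b (p.2, q.1))

/-- With a pure product resource, each pair of first-round Kraus operators leaves a product of a
left and a right vector. Only the exchange of messages makes the second-round amplitude fail to
factorise. -/
theorem Protocol.run_ketbra (P : Protocol A B A' B' L R) (c : L → ℂ) (d : R → ℂ) (φ : A → ℂ)
    (χ : B → ℂ) (y : A') (z : B') :
    P.run (ketbra c ⊗ₖ ketbra d) (ketbra φ ⊗ₖ ketbra χ) (y, z) (y, z)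
      = ((∑ i, ∑ j, ∑ u, ∑ v, ‖P.amplitude u v y z
          (P.VA.kraus i *ᵥ fun p => φ p.1 * c p.2)
          (P.VB.kraus j *ᵥ fun p => d p.1 * χ p.2)‖ ^ 2 : ℝ) : ℂ) := by
  have hin : ((ketbra φ ⊗ₖ ketbra χ) ⊗ₖ (ketbra c ⊗ₖ ketbra d)).submatrix
      (fun p : (A × L) × (R × B) => ((p.1.1, p.2.2), (p.1.2, p.2.1)))
      (fun p => ((p.1.1, p.2.2), (p.1.2, p.2.1)))
      = ketbra fun p => (fun p : A × L => φ p.1 * c p.2) p.1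
          * (fun p : R × B => d p.1 * χ p.2) p.2 := by
    rw [ketbra_kronecker, ketbra_kronecker, ketbra_kronecker, ketbra_submatrix]
    congr 1
    ext p
    simp only [Function.comp]
    ring
  simp only [Protocol.run]
  rw [hin, Channel.tensor_apply_ketbra]
  simp only [kronecker_mulVec_mul (v := fun p : A × L => φ p.1 * c p.2)
    (w := fun p : R × B => d p.1 * χ p.2), submatrix_sum, ketbra_submatrix, Channel.apply_sum,
    Channel.tensor_apply_ketbra, Matrix.sum_apply, ketbra_apply_self]
  push_cast
  refine Finset.sum_congr rfl fun i _ => Finset.sum_congr rfl fun j _ =>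
    Finset.sum_congr rfl fun u _ => Finset.sum_congr rfl fun v _ => ?_
  congr 3
  simp only [Protocol.amplitude, Matrix.mulVec, dotProduct, Matrix.kroneckerMap_apply,
    Fintype.sum_prod_type, Function.comp]

variable {n : ℕ}

theorem outputProb_kronecker (P : BB84Protocol n L R) {s t : Type*} [Fintype s] [Fintype t]
    (c : s → L → ℂ) (d : t → R → ℂ) (θ x y z : Bits n) :
    outputProb P ((∑ l, ketbra (c l)) ⊗ₖ (∑ m, ketbra (d m))) θ x y z
      = ∑ l, ∑ m, ∑ i, ∑ j, ∑ u, ∑ v, ‖P.amplitude u v y z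
          (P.VA.kraus i *ᵥ fun p => bb84VecN θ x p.1 * c l p.2)
          (P.VB.kraus j *ᵥ fun p => d m p.1 * (Pi.single θ 1 : Bits n → ℂ) p.2)‖ ^ 2 := by
  have hk : (∑ l, ketbra (c l)) ⊗ₖ (∑ m, ketbra (d m))
      = ∑ l, ∑ m, ketbra (c l) ⊗ₖ ketbra (d m) := by
    ext a b
    simp only [Matrix.kroneckerMap_apply, Matrix.sum_apply, Finset.sum_mul_sum]
  have hl := map_sum (P.runLinear (bb84Input θ x))
    (fun l => ∑ m, ketbra (c l) ⊗ₖ ketbra (d m)) Finset.univ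
  simp only [map_sum] at hl
  rw [outputProb, hk]
  change ((P.runLinear (bb84Input θ x) _) (y, z) (y, z)).re = _
  simp only [map_sum, Matrix.sum_apply, Complex.re_sum]
  refine Finset.sum_congr rfl fun l _ => Finset.sum_congr rfl fun m _ => ?_
  change (P.run _ _ (y, z) (y, z)).re = _
  rw [bb84Input, Protocol.run_ketbra, Complex.ofReal_re]

end Run

/-! ### One-sided measurement operators -/

section OneSided

set_option linter.unusedSectionVars false

variable {n : ℕ} {E E' K M : Type*} [Fintype E] [Fintype E'] [Fintype K] [DecidableEq K] [Fintype M]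
  [DecidableEq M]

/-- The operator that measures the qubits in the basis `θ` with outcome `x`, applies `V` to the left
system, and keeps the outcomes that agree with `x` on `S`. -/
def leftOperator (S : Finset (Fin n)) (θ : Bits n) (V : Matrix (Bits n × E) K ℂ) :
    Matrix (Bits n × (Bits n × E) × M) (Bits n × K × M) ℂ :=
  fun p q => if AgreeOn S p.1 p.2.1.1 then
    (if p.2.2 = q.2.2 then bb84VecN θ p.1 q.1 * V p.2.1 q.2.1 else 0) else 0

/-- The operator that measures the qubits in the basis `θ` with outcome `x`, applies `W` to the
right system, and keeps the outcomes that agree with `x` on `S`. -/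
def rightOperator (S : Finset (Fin n)) (θ : Bits n) (W : Matrix (Bits n × E) M ℂ) :
    Matrix (Bits n × (Bits n × E) × K) (Bits n × K × M) ℂ :=
  fun p q => if AgreeOn S p.1 p.2.1.1 then
    (if p.2.2 = q.2.1 then bb84VecN θ p.1 q.1 * W p.2.1 q.2.2 else 0) else 0

/-- The vector of the two systems after projecting the qubits on `⊗ᵢ H^θᵢ |xᵢ⟩`. -/
def partialVec (θ x : Bits n) (ψ : Bits n × K × M → ℂ) : K × M → ℂ :=
  fun p => ∑ q, bb84VecN θ x q * ψ (q, p.1, p.2)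

theorem leftOperator_mulVec (S : Finset (Fin n)) (θ : Bits n) (V : Matrix (Bits n × E) K ℂ)
    (ψ : Bits n × K × M → ℂ) (x : Bits n) (r : Bits n × E) (m : M) :
    (leftOperator S θ V *ᵥ ψ) (x, r, m)
      = if AgreeOn S x r.1 then ∑ k, V r k * partialVec θ x ψ (k, m) else 0 := by
  simp only [Matrix.mulVec, dotProduct, leftOperator, partialVec]
  split_ifs with h
  · simp only [Fintype.sum_prod_type, ite_mul, zero_mul, Finset.sum_ite_eq, Finset.mem_univ,
      if_true, Finset.mul_sum]
    rw [Finset.sum_comm]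
    exact Finset.sum_congr rfl fun k _ => Finset.sum_congr rfl fun q _ => by ring
  · simp

theorem rightOperator_mulVec (S : Finset (Fin n)) (θ : Bits n) (W : Matrix (Bits n × E) M ℂ)
    (ψ : Bits n × K × M → ℂ) (x : Bits n) (r : Bits n × E) (k : K) :
    (rightOperator S θ W *ᵥ ψ) (x, r, k)
      = if AgreeOn S x r.1 then ∑ m, W r m * partialVec θ x ψ (k, m) else 0 := by
  simp only [Matrix.mulVec, dotProduct, rightOperator, partialVec]
  split_ifs with h
  · simp only [Fintype.sum_prod_type, ite_mul, zero_mul, Finset.mul_sum]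
    rw [Finset.sum_comm]
    rw [Finset.sum_eq_single k (fun k' _ hk => by simp [hk.symm]) (by simp)]
    rw [Finset.sum_comm]
    simp only [if_true]
    exact Finset.sum_congr rfl fun k _ => Finset.sum_congr rfl fun q _ => by ring
  · simp

/-- `V` touches only `K` and `W` only `M`, so the two operators interact through the qubits alone
and the product splits into three factors. -/
theorem leftOperator_mul_rightOperator (S : Finset (Fin n)) (θ θ' : Bits n)
    (V : Matrix (Bits n × E) K ℂ) (W : Matrix (Bits n × E') M ℂ) (x x' : Bits n)
    (r : Bits n × E) (r' : Bits n × E') (m : M) (k : K) :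
    (leftOperator (M := M) S θ V * (rightOperator (K := K) S θ' W)ᴴ) (x, r, m) (x', r', k)
      = V r k * star (W r' m) * restrictedOverlap S θ θ' r.1 r'.1 x x' := by
  rw [Matrix.mul_apply]
  simp only [Matrix.conjTranspose_apply, leftOperator, rightOperator,
    restrictedOverlap]
  by_cases h1 : AgreeOn S x r.1
  · by_cases h2 : AgreeOn S x' r'.1
    · simp only [if_pos h1, if_pos h2, if_pos (And.intro h1 h2), Fintype.sum_prod_type, ite_mul, zero_mul,
        Finset.sum_ite_eq, Finset.mem_univ, Finset.mul_sum]
      refine Finset.sum_congr rfl fun q _ => ?_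
      rw [Finset.sum_eq_single k (fun k' _ hk => by simp [hk.symm]) (by simp)]
      simp only [if_true, star_mul']
      ring
    · simp only [if_neg h2, if_neg fun h : _ ∧ _ => h2 h.2]
      simp
  · simp only [if_neg h1, if_neg fun h : _ ∧ _ => h1 h.1]
    simp

theorem sum_reorder {α β γ α' β' γ' : Type*} [Fintype α] [Fintype β] [Fintype γ] [Fintype α']
    [Fintype β'] [Fintype γ'] (F : α → β → γ → α' → β' → γ' → ℂ) :
    ∑ x, ∑ r, ∑ m, ∑ x', ∑ r', ∑ k, F x r m x' r' k
      = ∑ r, ∑ r', ∑ x, ∑ x', ∑ m, ∑ k, F x r m x' r' k := by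
  rw [Finset.sum_comm]
  refine Finset.sum_congr rfl fun r _ => ?_
  calc ∑ x, ∑ m, ∑ x', ∑ r', ∑ k, F x r m x' r' k
      = ∑ x, ∑ m, ∑ r', ∑ x', ∑ k, F x r m x' r' k :=
        Finset.sum_congr rfl fun x _ => Finset.sum_congr rfl fun m _ => Finset.sum_comm
    _ = ∑ x, ∑ r', ∑ m, ∑ x', ∑ k, F x r m x' r' k :=
        Finset.sum_congr rfl fun x _ => Finset.sum_comm
    _ = ∑ r', ∑ x, ∑ m, ∑ x', ∑ k, F x r m x' r' k := Finset.sum_comm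
    _ = _ := Finset.sum_congr rfl fun r' _ => Finset.sum_congr rfl fun x _ => Finset.sum_comm

open scoped Matrix.Norms.L2Operator in
/-- Measurements on different systems in the bases `θ` and `θ'` are nearly orthogonal. -/
theorem norm_leftOperator_mul_rightOperator_le [DecidableEq E] [DecidableEq E']
    (S : Finset (Fin n)) (θ θ' : Bits n)
    (V : Matrix (Bits n × E) K ℂ) (W : Matrix (Bits n × E') M ℂ)
    (hV : ∀ v : K → ℂ, ∑ r, ‖∑ k, V r k * v k‖ ^ 2 = ∑ k, ‖v k‖ ^ 2)
    (hW : ∀ v : M → ℂ, ∑ r, ‖∑ m, W r m * v m‖ ^ 2 = ∑ m, ‖v m‖ ^ 2) :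
    ‖leftOperator (M := M) S θ V * (rightOperator (K := K) S θ' W)ᴴ‖
      ≤ overlapBoundOn S θ θ' := by
  have hd := overlapBoundOn_nonneg S θ θ'
  refine opNorm_le_of_dotProduct _ hd fun f g => ?_
  -- The factors `W` and `V` are absorbed into the test vectors. Being isometries they preserve
  -- total norm (`hF`, `hG`), so that only the restricted overlap matrices, one for each pair `r`,
  -- `r'`, remain to be estimated.
  set f1 : Bits n × E → Bits n × E' → Bits n → ℂ := fun r r' x => ∑ m, W r' m * f (x, r, m) with hf1
  set g1 : Bits n × E → Bits n × E' → Bits n → ℂ := fun r r' x => ∑ k, V r k * g (x, r', k) with hg1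
  have key : star f ⬝ᵥ ((leftOperator (M := M) S θ V * (rightOperator (K := K) S θ' W)ᴴ) *ᵥ g)
      = ∑ r, ∑ r', star (f1 r r') ⬝ᵥ (restrictedOverlap S θ θ' r.1 r'.1 *ᵥ g1 r r') := by
    simp only [dotProduct, Matrix.mulVec, Pi.star_apply]
    have e1 : ∑ p, star (f p) * ∑ q, (leftOperator (M := M) S θ V * (rightOperator (K := K) S θ' W)ᴴ) p q * g q
        = ∑ x, ∑ r, ∑ m, ∑ x', ∑ r', ∑ k, star (f (x, r, m)) *
          (V r k * star (W r' m) * restrictedOverlap S θ θ' r.1 r'.1 x x' * g (x', r', k)) := by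
      rw [Fintype.sum_prod_type]
      refine Finset.sum_congr rfl fun x _ => ?_
      rw [Fintype.sum_prod_type]
      refine Finset.sum_congr rfl fun r _ => Finset.sum_congr rfl fun m _ => ?_
      rw [Finset.mul_sum, Fintype.sum_prod_type]
      refine Finset.sum_congr rfl fun x' _ => ?_
      rw [Fintype.sum_prod_type]
      refine Finset.sum_congr rfl fun r' _ => Finset.sum_congr rfl fun k _ => ?_
      rw [leftOperator_mul_rightOperator]
    rw [e1, sum_reorder]
    refine Finset.sum_congr rfl fun r _ => Finset.sum_congr rfl fun r' _ =>
      Finset.sum_congr rfl fun x _ => ?_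
    rw [Finset.mul_sum]
    refine Finset.sum_congr rfl fun x' _ => ?_
    simp only [hf1, hg1, star_sum, star_mul', Finset.mul_sum, Finset.sum_mul]
    refine (Finset.sum_comm).trans ?_
    exact Finset.sum_congr rfl fun k _ => Finset.sum_congr rfl fun m _ => by ring
  have hF : ∑ r, ∑ r', ‖WithLp.toLp 2 (f1 r r')‖ ^ 2 = ‖WithLp.toLp 2 f‖ ^ 2 := by
    simp only [norm_toLp_sq, Fintype.sum_prod_type (f := fun p => ‖f p‖ ^ 2)]
    have : ∀ r, ∑ r', ∑ x, ‖f1 r r' x‖ ^ 2 = ∑ x, ∑ m, ‖f (x, r, m)‖ ^ 2 := fun r => by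
      rw [Finset.sum_comm]
      exact Finset.sum_congr rfl fun x _ => hW fun m => f (x, r, m)
    rw [Finset.sum_congr rfl fun r _ => this r, Finset.sum_comm]
    exact Finset.sum_congr rfl fun x _ =>
      (Fintype.sum_prod_type fun p : (Bits n × E) × M => ‖f (x, p)‖ ^ 2).symm
  have hG : ∑ r, ∑ r', ‖WithLp.toLp 2 (g1 r r')‖ ^ 2 = ‖WithLp.toLp 2 g‖ ^ 2 := by
    simp only [norm_toLp_sq, Fintype.sum_prod_type (f := fun p => ‖g p‖ ^ 2)]
    have : ∀ r', ∑ r, ∑ x, ‖g1 r r' x‖ ^ 2 = ∑ x, ∑ k, ‖g (x, r', k)‖ ^ 2 := fun r' => by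
      rw [Finset.sum_comm]
      exact Finset.sum_congr rfl fun x _ => hV fun k => g (x, r', k)
    rw [Finset.sum_comm, Finset.sum_congr rfl fun r _ => this r, Finset.sum_comm]
    exact Finset.sum_congr rfl fun x _ =>
      (Fintype.sum_prod_type fun p : (Bits n × E') × K => ‖g (x, p)‖ ^ 2).symm
  have hCS : ∑ r, ∑ r', ‖WithLp.toLp 2 (f1 r r')‖ * ‖WithLp.toLp 2 (g1 r r')‖
      ≤ ‖WithLp.toLp 2 f‖ * ‖WithLp.toLp 2 g‖ := by
    refine abs_le_of_sq_le_sq' ?_ (by positivity) |>.2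
    rw [mul_pow, ← hF, ← hG]
    simp only [← Fintype.sum_prod_type']
    exact Finset.sum_mul_sq_le_sq_mul_sq _ _ _
  rw [key]
  calc ‖∑ r, ∑ r', star (f1 r r') ⬝ᵥ (restrictedOverlap S θ θ' r.1 r'.1 *ᵥ g1 r r')‖
      ≤ ∑ r, ∑ r', overlapBoundOn S θ θ'
          * (‖WithLp.toLp 2 (f1 r r')‖ * ‖WithLp.toLp 2 (g1 r r')‖) := by
        refine (norm_sum_le _ _).trans (Finset.sum_le_sum fun r _ =>
          (norm_sum_le _ _).trans (Finset.sum_le_sum fun r' _ => ?_))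
        refine (norm_star_dotProduct_le _ _).trans ?_
        have := (norm_mulVec_le (restrictedOverlap S θ θ' r.1 r'.1) (g1 r r')).trans
          (mul_le_mul_of_nonneg_right (norm_restrictedOverlap_le S θ θ' r.1 r'.1) (norm_nonneg _))
        nlinarith [mul_le_mul_of_nonneg_left this (norm_nonneg (WithLp.toLp 2 (f1 r r')))]
    _ ≤ overlapBoundOn S θ θ' * (‖WithLp.toLp 2 f‖ * ‖WithLp.toLp 2 g‖) := by
        simp only [← Finset.mul_sum]
        exact mul_le_mul_of_nonneg_left hCS hd

open scoped Matrix.Norms.L2Operator in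
/-- Operators dominated by measurements on both systems cannot be aligned for all bases. -/
theorem sum_norm_mulVec_sq_le_of_dominated {Y : Type*} [Fintype Y] (S : Finset (Fin n))
    (T : Bits n → Matrix Y (Bits n × K × M) ℂ) (V : Bits n → Matrix (Bits n × E) K ℂ)
    (W : Bits n → Matrix (Bits n × E') M ℂ)
    (hV : ∀ θ (v : K → ℂ), ∑ r, ‖∑ k, V θ r k * v k‖ ^ 2 = ∑ k, ‖v k‖ ^ 2)
    (hW : ∀ θ (v : M → ℂ), ∑ r, ‖∑ m, W θ r m * v m‖ ^ 2 = ∑ m, ‖v m‖ ^ 2)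
    (hl : ∀ θ ψ, ‖WithLp.toLp 2 (T θ *ᵥ ψ)‖
      ≤ ‖WithLp.toLp 2 (leftOperator (M := M) S θ (V θ) *ᵥ ψ)‖)
    (hr : ∀ θ ψ, ‖WithLp.toLp 2 (T θ *ᵥ ψ)‖
      ≤ ‖WithLp.toLp 2 (rightOperator (K := K) S θ (W θ) *ᵥ ψ)‖)
    (ψ : Bits n × K × M → ℂ) :
    ∑ θ, ‖WithLp.toLp 2 (T θ *ᵥ ψ)‖ ^ 2
      ≤ 2 ^ n * (Real.cos (Real.pi / 8) ^ 2) ^ S.card * ‖WithLp.toLp 2 ψ‖ ^ 2 := by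
  have := Classical.decEq Y
  have := Classical.decEq E
  have := Classical.decEq E'
  refine sum_norm_mulVec_sq_le T (overlapBoundOn S) (fun θ θ' => ?_) (overlapBoundOn_comm S) _
    (fun θ => (sum_overlapBoundOn S θ).le) ψ
  exact (opNorm_mul_conjTranspose_le _ _ _ _ (hl θ) (hr θ')).trans
    (norm_leftOperator_mul_rightOperator_le S θ θ' _ _ (hV θ) (hW θ'))

end OneSided

/-! ### The monogamy bound for product resource states -/

section Monogamy

set_option linter.unusedSectionVars false

variable {n : ℕ} {L R J : Type*} [Fintype L] [DecidableEq L] [Fintype R] [DecidableEq R] [Fintype J]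

theorem sum_reorder_four {α β γ δ N : Type*} [Fintype α] [Fintype β] [Fintype γ] [Fintype δ]
    [AddCommMonoid N] (F : α → β → γ → δ → N) :
    ∑ a, ∑ b, ∑ c, ∑ d, F a b c d = ∑ c, ∑ d, ∑ b, ∑ a, F a b c d := by
  let e : α × β × γ × δ ≃ γ × δ × β × α :=
    ⟨fun p => (p.2.2.1, p.2.2.2, p.2.1, p.1), fun p => (p.2.2.2, p.2.2.1, p.1, p.2.1),
      fun _ => rfl, fun _ => rfl⟩
  have := Fintype.sum_equiv e (fun p => F p.1 p.2.1 p.2.2.1 p.2.2.2)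
    (fun p => F p.2.2.2 p.2.2.1 p.1 p.2.1) fun _ => rfl
  simpa only [Fintype.sum_prod_type] using this

theorem sum_reorder_five {α β γ δ ε N : Type*} [Fintype α] [Fintype β] [Fintype γ] [Fintype δ]
    [Fintype ε] [AddCommMonoid N] (F : α → β → γ → δ → ε → N) :
    ∑ a, ∑ b, ∑ c, ∑ d, ∑ e, F a b c d e = ∑ c, ∑ d, ∑ e, ∑ b, ∑ a, F a b c d e := by
  rw [Finset.sum_comm]
  simp only [← Fintype.sum_prod_type']
  refine Fintype.sum_equiv ⟨fun p => (p.2.2.1, p.2.2.2.1, p.2.2.2.2, p.1, p.2.1),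
    fun p => (p.2.2.2.1, p.2.2.2.2, p.1, p.2.1, p.2.2.1), fun _ => rfl, fun _ => rfl⟩ _ _ fun _ => rfl

/-- The second round measurement on the left, with the message system filled in from `b`. -/
def leftMeasurement (P : BB84Protocol n L R) (b : J → Fin P.ma × Fin P.kb → ℂ) :
    Matrix (Bits n × (P.WA.ι × J × Fin P.kb)) (Fin P.ka) ℂ :=
  fun r k => ∑ m, P.WA.kraus r.2.1 r.1 (k, m) * b r.2.2.1 (m, r.2.2.2)

/-- The second round measurement on the right, with the kept system filled in from `b`. -/
def rightMeasurement (P : BB84Protocol n L R) (b : J → Fin P.ma × Fin P.kb → ℂ) :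
    Matrix (Bits n × (P.WB.ι × J × Fin P.ma)) (Fin P.mb) ℂ :=
  fun r m => ∑ k, P.WB.kraus r.2.1 r.1 (k, m) * b r.2.2.1 (r.2.2.2, k)

/-- Adjoining the normalised ancilla `b` and then applying the Kraus operators of `WA` is isometric
once the Kraus index, the index `j` and the unused register `K_b` are recorded along with the
outcome. -/
theorem leftMeasurement_isometry (P : BB84Protocol n L R) (b : J → Fin P.ma × Fin P.kb → ℂ)
    (hb : ∑ j, ∑ p, ‖b j p‖ ^ 2 = 1) (v : Fin P.ka → ℂ) :
    ∑ r, ‖∑ k, leftMeasurement P b r k * v k‖ ^ 2 = ∑ k, ‖v k‖ ^ 2 := by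
  have h1 : ∀ y u j l, ∑ k, leftMeasurement P b (y, u, j, l) k * v k
      = (P.WA.kraus u *ᵥ fun p => v p.1 * b j (p.2, l)) y := by
    intro y u j l
    simp only [leftMeasurement, Matrix.mulVec, dotProduct, Fintype.sum_prod_type, Finset.sum_mul]
    exact Finset.sum_congr rfl fun k _ => Finset.sum_congr rfl fun m _ => by ring
  calc ∑ r, ‖∑ k, leftMeasurement P b r k * v k‖ ^ 2
      = ∑ j, ∑ l, ∑ u, ∑ y, ‖(P.WA.kraus u *ᵥ fun p => v p.1 * b j (p.2, l)) y‖ ^ 2 := by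
        simp only [Fintype.sum_prod_type, h1]
        rw [Finset.sum_comm]
        simp only [Finset.sum_comm (s := (Finset.univ : Finset (Bits n)))]
        rw [Finset.sum_comm]
        exact Finset.sum_congr rfl fun j _ => Finset.sum_comm
    _ = ∑ j, ∑ l, ∑ k, ∑ m, ‖v k‖ ^ 2 * ‖b j (m, l)‖ ^ 2 := by
        simp only [Channel.sum_norm_mulVec_sq, Fintype.sum_prod_type, norm_mul, mul_pow]
    _ = (∑ k, ‖v k‖ ^ 2) * ∑ j, ∑ p, ‖b j p‖ ^ 2 := by
        rw [Finset.mul_sum]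
        refine Finset.sum_congr rfl fun j _ => ?_
        rw [Fintype.sum_prod_type_right, Finset.mul_sum]
        refine Finset.sum_congr rfl fun l _ => ?_
        rw [Finset.sum_mul_sum]
    _ = ∑ k, ‖v k‖ ^ 2 := by rw [hb, mul_one]

theorem rightMeasurement_isometry (P : BB84Protocol n L R) (b : J → Fin P.ma × Fin P.kb → ℂ)
    (hb : ∑ j, ∑ p, ‖b j p‖ ^ 2 = 1) (v : Fin P.mb → ℂ) :
    ∑ r, ‖∑ m, rightMeasurement P b r m * v m‖ ^ 2 = ∑ m, ‖v m‖ ^ 2 := by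
  have h1 : ∀ z w j l, ∑ m, rightMeasurement P b (z, w, j, l) m * v m
      = (P.WB.kraus w *ᵥ fun p => b j (l, p.1) * v p.2) z := by
    intro z w j l
    simp only [rightMeasurement, Matrix.mulVec, dotProduct, Fintype.sum_prod_type, Finset.sum_mul]
    rw [Finset.sum_comm]
    exact Finset.sum_congr rfl fun k _ => Finset.sum_congr rfl fun m _ => by ring
  calc ∑ r, ‖∑ m, rightMeasurement P b r m * v m‖ ^ 2
      = ∑ j, ∑ l, ∑ w, ∑ z, ‖(P.WB.kraus w *ᵥ fun p => b j (l, p.1) * v p.2) z‖ ^ 2 := by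
        simp only [Fintype.sum_prod_type, h1]
        rw [Finset.sum_comm]
        simp only [Finset.sum_comm (s := (Finset.univ : Finset (Bits n)))]
        rw [Finset.sum_comm]
        exact Finset.sum_congr rfl fun j _ => Finset.sum_comm
    _ = ∑ j, ∑ l, ∑ k, ∑ m, ‖b j (l, k)‖ ^ 2 * ‖v m‖ ^ 2 := by
        simp only [Channel.sum_norm_mulVec_sq, Fintype.sum_prod_type, norm_mul, mul_pow]
    _ = (∑ j, ∑ p, ‖b j p‖ ^ 2) * ∑ m, ‖v m‖ ^ 2 := by
        rw [Finset.sum_mul]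
        refine Finset.sum_congr rfl fun j _ => ?_
        rw [Fintype.sum_prod_type, Finset.sum_mul]
        refine Finset.sum_congr rfl fun l _ => ?_
        rw [Finset.sum_mul_sum]
    _ = ∑ m, ‖v m‖ ^ 2 := by rw [hb, one_mul]

/-- The operator of the whole game in the basis `θ`, restricted to outcomes `y`, `z` that agree with
the outcome `x` of the measurement of the qubits on `S`. -/
def jointOperator (P : BB84Protocol n L R) (S : Finset (Fin n)) (θ : Bits n)
    (b : J → Fin P.ma × Fin P.kb → ℂ) :
    Matrix (Bits n × (Bits n × P.WA.ι) × (Bits n × P.WB.ι) × J)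
      (Bits n × Fin P.ka × Fin P.mb) ℂ :=
  fun p q => if AgreeOn S p.1 p.2.1.1 ∧ AgreeOn S p.1 p.2.2.1.1 then
    bb84VecN θ p.1 q.1 * ∑ m, ∑ k, P.WA.kraus p.2.1.2 p.2.1.1 (q.2.1, m)
      * P.WB.kraus p.2.2.1.2 p.2.2.1.1 (k, q.2.2) * b p.2.2.2 (m, k) else 0

theorem jointOperator_mulVec (P : BB84Protocol n L R) (S : Finset (Fin n)) (θ : Bits n)
    (b : J → Fin P.ma × Fin P.kb → ℂ) (ψ : Bits n × Fin P.ka × Fin P.mb → ℂ) (x y z : Bits n)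
    (u : P.WA.ι) (v : P.WB.ι) (j : J) :
    (jointOperator P S θ b *ᵥ ψ) (x, (y, u), (z, v), j)
      = if AgreeOn S x y ∧ AgreeOn S x z then
          P.amplitude u v y z (partialVec θ x ψ) (b j) else 0 := by
  simp only [Matrix.mulVec, dotProduct, jointOperator]
  split_ifs with h
  · simp only [Protocol.amplitude, partialVec, Fintype.sum_prod_type, Finset.mul_sum,
      Finset.sum_mul]
    rw [Finset.sum_comm]
    refine Finset.sum_congr rfl fun k _ => ?_
    rw [sum_reorder_four]
    refine Finset.sum_congr rfl fun m _ => Finset.sum_congr rfl fun k' _ =>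
      Finset.sum_congr rfl fun m' _ => Finset.sum_congr rfl fun q _ => ?_
    ring
  · simp

/-- Performing the left measurement first leaves the Kraus operator of `WB` outermost, so a sum over
all its indices and outcomes can be removed by its isometry property. -/
theorem amplitude_eq_left (P : BB84Protocol n L R) (b : J → Fin P.ma × Fin P.kb → ℂ)
    (χ : Fin P.ka × Fin P.mb → ℂ) (y z : Bits n) (u : P.WA.ι) (v : P.WB.ι) (j : J) :
    P.amplitude u v y z χ (b j)
      = (P.WB.kraus v *ᵥ fun q => ∑ k, leftMeasurement P b (y, u, j, q.1) k * χ (k, q.2)) z := by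
  simp only [Protocol.amplitude, leftMeasurement, Matrix.mulVec, dotProduct]
  rw [Finset.sum_comm]
  refine Finset.sum_congr rfl fun q _ => ?_
  rw [Fintype.sum_prod_type, Finset.mul_sum]
  refine Finset.sum_congr rfl fun k _ => ?_
  rw [Finset.sum_mul, Finset.mul_sum]
  exact Finset.sum_congr rfl fun m _ => by ring

theorem amplitude_eq_right (P : BB84Protocol n L R) (b : J → Fin P.ma × Fin P.kb → ℂ)
    (χ : Fin P.ka × Fin P.mb → ℂ) (y z : Bits n) (u : P.WA.ι) (v : P.WB.ι) (j : J) :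
    P.amplitude u v y z χ (b j)
      = (P.WA.kraus u *ᵥ fun p => ∑ m, rightMeasurement P b (z, v, j, p.2) m * χ (p.1, m)) y := by
  simp only [Protocol.amplitude, rightMeasurement, Matrix.mulVec, dotProduct]
  refine Finset.sum_congr rfl fun p _ => ?_
  rw [Fintype.sum_prod_type_right, Finset.mul_sum]
  refine Finset.sum_congr rfl fun m _ => ?_
  rw [Finset.sum_mul, Finset.mul_sum]
  exact Finset.sum_congr rfl fun k _ => by ring

/-- Dropping the condition on `z` only adds nonnegative terms, and summing over every right outcome
erases the right measurement. -/
theorem norm_jointOperator_le_left (P : BB84Protocol n L R) (S : Finset (Fin n)) (θ : Bits n)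
    (b : J → Fin P.ma × Fin P.kb → ℂ) (ψ : Bits n × Fin P.ka × Fin P.mb → ℂ) :
    ‖WithLp.toLp 2 (jointOperator P S θ b *ᵥ ψ)‖
      ≤ ‖WithLp.toLp 2 (leftOperator (M := Fin P.mb) S θ (leftMeasurement P b) *ᵥ ψ)‖ := by
  refine le_of_sq_le_sq ?_ (norm_nonneg _)
  rw [norm_toLp_sq, norm_toLp_sq]
  simp only [Fintype.sum_prod_type, jointOperator_mulVec, leftOperator_mulVec]
  refine Finset.sum_le_sum fun x _ => Finset.sum_le_sum fun y _ => Finset.sum_le_sum fun u _ => ?_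
  by_cases h : AgreeOn S x y
  · calc _ ≤ ∑ z, ∑ v, ∑ j, ‖P.amplitude u v y z (partialVec θ x ψ) (b j)‖ ^ 2 := by
          refine Finset.sum_le_sum fun z _ => Finset.sum_le_sum fun v _ =>
            Finset.sum_le_sum fun j _ => ?_
          split_ifs
          · rfl
          · exact le_of_eq_of_le (by simp) (sq_nonneg _)
      _ = ∑ j, ∑ v, ∑ z, ‖P.amplitude u v y z (partialVec θ x ψ) (b j)‖ ^ 2 := by
          rw [Finset.sum_comm]
          simp only [Finset.sum_comm (s := (Finset.univ : Finset (Bits n)))]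
          rw [Finset.sum_comm]
      _ = _ := by
          simp only [amplitude_eq_left, Channel.sum_norm_mulVec_sq, Fintype.sum_prod_type, if_pos h]
  · simp only [if_neg h, if_neg fun h' : _ ∧ _ => h h'.1]
    simp

theorem norm_jointOperator_le_right (P : BB84Protocol n L R) (S : Finset (Fin n)) (θ : Bits n)
    (b : J → Fin P.ma × Fin P.kb → ℂ) (ψ : Bits n × Fin P.ka × Fin P.mb → ℂ) :
    ‖WithLp.toLp 2 (jointOperator P S θ b *ᵥ ψ)‖
      ≤ ‖WithLp.toLp 2 (rightOperator (K := Fin P.ka) S θ (rightMeasurement P b) *ᵥ ψ)‖ := by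
  refine le_of_sq_le_sq ?_ (norm_nonneg _)
  rw [norm_toLp_sq, norm_toLp_sq]
  simp only [Fintype.sum_prod_type, jointOperator_mulVec, rightOperator_mulVec]
  refine Finset.sum_le_sum fun x _ => ?_
  rw [sum_reorder_five]
  refine Finset.sum_le_sum fun z _ => Finset.sum_le_sum fun v _ => Finset.sum_le_sum fun j _ => ?_
  by_cases h : AgreeOn S x z
  · calc _ ≤ ∑ u, ∑ y, ‖P.amplitude u v y z (partialVec θ x ψ) (b j)‖ ^ 2 := by
          refine Finset.sum_le_sum fun u _ => Finset.sum_le_sum fun y _ => ?_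
          split_ifs
          · rfl
          · exact le_of_eq_of_le (by simp) (sq_nonneg _)
      _ = ∑ k, ∑ m, ‖∑ m', rightMeasurement P b (z, v, j, m) m'
            * partialVec θ x ψ (k, m')‖ ^ 2 := by
          simp only [amplitude_eq_right, Channel.sum_norm_mulVec_sq, Fintype.sum_prod_type]
      _ = _ := by
          rw [Finset.sum_comm]
          simp only [if_pos h]
  · simp only [if_neg h, if_neg fun h' : _ ∧ _ => h h'.2]
    simp

/-- The monogamy-of-entanglement bound. -/
theorem sum_norm_jointOperator_le (P : BB84Protocol n L R) (S : Finset (Fin n))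
    (b : Bits n → J → Fin P.ma × Fin P.kb → ℂ) (hb : ∀ θ, ∑ j, ∑ p, ‖b θ j p‖ ^ 2 = 1)
    (ψ : Bits n × Fin P.ka × Fin P.mb → ℂ) :
    ∑ θ, ‖WithLp.toLp 2 (jointOperator P S θ (b θ) *ᵥ ψ)‖ ^ 2
      ≤ 2 ^ n * (Real.cos (Real.pi / 8) ^ 2) ^ S.card * ‖WithLp.toLp 2 ψ‖ ^ 2 := by
  exact sum_norm_mulVec_sq_le_of_dominated S _ (fun θ => leftMeasurement P (b θ))
    (fun θ => rightMeasurement P (b θ)) (fun θ => leftMeasurement_isometry P (b θ) (hb θ))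
    (fun θ => rightMeasurement_isometry P (b θ) (hb θ))
    (fun θ => norm_jointOperator_le_left P S θ (b θ))
    (fun θ => norm_jointOperator_le_right P S θ (b θ)) ψ

end Monogamy

/-! ### Success probabilities for product and separable resource states -/

section Success

variable {n : ℕ} {L R : Type*} [Fintype L] [DecidableEq L] [Fintype R] [DecidableEq R]

theorem sum_reorder_nine {α β γ δ ε ζ η κ μ N : Type*} [Fintype α] [Fintype β] [Fintype γ]
    [Fintype δ] [Fintype ε] [Fintype ζ] [Fintype η] [Fintype κ] [Fintype μ] [AddCommMonoid N]
    (F : α → β → γ → δ → ε → ζ → η → κ → μ → N) :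
    ∑ x, ∑ y, ∑ z, ∑ l, ∑ m, ∑ i, ∑ j, ∑ u, ∑ v, F x y z l m i j u v
      = ∑ l, ∑ i, ∑ x, ∑ y, ∑ u, ∑ z, ∑ v, ∑ m, ∑ j, F x y z l m i j u v := by
  have := Fintype.sum_equiv
    (⟨fun ⟨x, y, z, l, m, i, j, u, v⟩ => (l, i, x, y, u, z, v, m, j),
      fun ⟨l, i, x, y, u, z, v, m, j⟩ => (x, y, z, l, m, i, j, u, v),
      fun _ => rfl, fun _ => rfl⟩ :
      α × β × γ × δ × ε × ζ × η × κ × μ ≃ δ × ζ × α × β × κ × γ × μ × ε × η)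
    (fun ⟨x, y, z, l, m, i, j, u, v⟩ => F x y z l m i j u v)
    (fun ⟨l, i, x, y, u, z, v, m, j⟩ => F x y z l m i j u v) fun _ => rfl
  simpa only [Fintype.sum_prod_type] using this

theorem sum_norm_sq_of_isDensity {A : Type*} [Fintype A] {σ : Matrix A A ℂ} (hσ : IsDensity σ)
    {s : Type*} [Fintype s] {c : s → A → ℂ} (hc : σ = ∑ l, ketbra (c l)) :
    ∑ l, ∑ a, ‖c l a‖ ^ 2 = 1 := by
  have h := hσ.2
  rw [hc, Matrix.trace_sum] at h
  simp only [Matrix.trace, Matrix.diag_apply, ketbra_apply_self] at h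
  exact_mod_cast h

theorem sum_norm_bb84_single (θ : Bits n) :
    ∑ q, ‖(Pi.single θ 1 : Bits n → ℂ) q‖ ^ 2 = 1 := by
  rw [Finset.sum_eq_single θ]
  · simp
  · intro q _ hq; simp [hq]
  · simp

theorem outputProb_nonneg (P : BB84Protocol n L R) {σ : Matrix L L ℂ} {τ : Matrix R R ℂ}
    (hσ : IsDensity σ) (hτ : IsDensity τ) (θ x y z : Bits n) :
    0 ≤ outputProb P (σ ⊗ₖ τ) θ x y z := by
  obtain ⟨c, rfl⟩ := posSemidef_eq_sum_ketbra hσ.1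
  obtain ⟨d, rfl⟩ := posSemidef_eq_sum_ketbra hτ.1
  rw [outputProb_kronecker]
  positivity

/-- The probability that both outputs are correct on `S`, up to normalization. -/
theorem sum_outputProb_agree_le (P : BB84Protocol n L R) (S : Finset (Fin n)) {σ : Matrix L L ℂ}
    {τ : Matrix R R ℂ} (hσ : IsDensity σ) (hτ : IsDensity τ) :
    ∑ θ, ∑ x, ∑ y, ∑ z, (if AgreeOn S x y ∧ AgreeOn S x z then
      outputProb P (σ ⊗ₖ τ) θ x y z else 0)
      ≤ 2 ^ n * 2 ^ n * (Real.cos (Real.pi / 8) ^ 2) ^ S.card := by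
  obtain ⟨c, hc⟩ := posSemidef_eq_sum_ketbra hσ.1
  obtain ⟨d, hd⟩ := posSemidef_eq_sum_ketbra hτ.1
  have hc1 := sum_norm_sq_of_isDensity hσ hc
  have hd1 := sum_norm_sq_of_isDensity hτ hd
  -- Alice's operation applied to halves of `n` unnormalised EPR pairs; the first component is the
  -- reference. Neither `θ` nor `x` occurs.
  let ψ : L → P.VA.ι → Bits n × Fin P.ka × Fin P.mb → ℂ := fun l i p =>
    ∑ l', P.VA.kraus i p.2 (p.1, l') * c l l'
  let b : Bits n → R × P.VB.ι → Fin P.ma × Fin P.kb → ℂ := fun θ j =>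
    P.VB.kraus j.2 *ᵥ fun p => d j.1 p.1 * (Pi.single θ 1 : Bits n → ℂ) p.2
  -- By linearity, contracting the reference with the coefficients of the BB84 vector amounts to
  -- feeding that vector to Alice; hence `partialVec` takes no conjugate.
  have hψ : ∀ θ x l i, P.VA.kraus i *ᵥ (fun p => bb84VecN θ x p.1 * c l p.2)
      = partialVec θ x (ψ l i) := by
    intro θ x l i
    ext p
    simp only [Matrix.mulVec, dotProduct, partialVec, ψ, Fintype.sum_prod_type, Finset.mul_sum]
    exact Finset.sum_congr rfl fun q _ => Finset.sum_congr rfl fun l' _ => by ring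
  have hb : ∀ θ, ∑ j, ∑ p, ‖b θ j p‖ ^ 2 = 1 := by
    intro θ
    rw [Fintype.sum_prod_type]
    simp only [b, Channel.sum_norm_mulVec_sq]
    simp only [Fintype.sum_prod_type, norm_mul, mul_pow, ← Finset.mul_sum, sum_norm_bb84_single,
      mul_one]
    exact hd1
  -- Unnormalised EPR pairs contribute one unit for each of the `2 ^ n` basis strings. The other `2
  -- ^ n` in the final bound comes from the sum over `θ`.
  have hψ1 : ∑ l, ∑ i, ‖WithLp.toLp 2 (ψ l i)‖ ^ 2 = 2 ^ n := by
    have h1 : ∀ l, ∑ i, ‖WithLp.toLp 2 (ψ l i)‖ ^ 2 = 2 ^ n * ∑ a, ‖c l a‖ ^ 2 := by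
      intro l
      have h2 : ∀ i q p, ψ l i (q, p)
          = (P.VA.kraus i *ᵥ fun r => (Pi.single q 1 : Bits n → ℂ) r.1 * c l r.2) p := by
        intro i q p
        simp only [Matrix.mulVec, dotProduct, Fintype.sum_prod_type, ψ]
        rw [Finset.sum_eq_single q]
        · simp
        · intro q' _ hq; simp [hq]
        · simp
      calc ∑ i, ‖WithLp.toLp 2 (ψ l i)‖ ^ 2
          = ∑ i, ∑ q, ∑ p, ‖ψ l i (q, p)‖ ^ 2 := Finset.sum_congr rfl fun i _ => by
            rw [norm_toLp_sq, Fintype.sum_prod_type]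
        _ = ∑ q, ∑ r : Bits n × L, ‖(Pi.single q 1 : Bits n → ℂ) r.1 * c l r.2‖ ^ 2 := by
            rw [Finset.sum_comm]
            simp only [h2, Channel.sum_norm_mulVec_sq]
        _ = 2 ^ n * ∑ a, ‖c l a‖ ^ 2 := by
            simp only [Fintype.sum_prod_type, norm_mul, mul_pow, ← Finset.mul_sum,
              ← Finset.sum_mul, sum_norm_bb84_single, one_mul]
            simp
    rw [Finset.sum_congr rfl fun l _ => h1 l, ← Finset.mul_sum, hc1, mul_one]
  have key : ∀ θ, ∑ x, ∑ y, ∑ z, (if AgreeOn S x y ∧ AgreeOn S x z then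
      outputProb P (σ ⊗ₖ τ) θ x y z else 0)
      = ∑ l, ∑ i, ‖WithLp.toLp 2 (jointOperator P S θ (b θ) *ᵥ ψ l i)‖ ^ 2 := by
    intro θ
    have h1 : ∀ x y z, (if AgreeOn S x y ∧ AgreeOn S x z then
        outputProb P (σ ⊗ₖ τ) θ x y z else 0)
        = ∑ l, ∑ m, ∑ i, ∑ j, ∑ u, ∑ v, ‖if AgreeOn S x y ∧ AgreeOn S x z then
          P.amplitude u v y z (partialVec θ x (ψ l i)) (b θ (m, j)) else 0‖ ^ 2 := by
      intro x y z
      split_ifs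
      · rw [hc, hd, outputProb_kronecker]
        simp only [hψ, b]
      · simp
    simp only [h1]
    rw [sum_reorder_nine]
    simp only [norm_toLp_sq, Fintype.sum_prod_type, jointOperator_mulVec]
  calc _ = ∑ l, ∑ i, ∑ θ, ‖WithLp.toLp 2 (jointOperator P S θ (b θ) *ᵥ ψ l i)‖ ^ 2 := by
        rw [Finset.sum_congr rfl fun θ _ => key θ, Finset.sum_comm]
        exact Finset.sum_congr rfl fun l _ => Finset.sum_comm
    _ ≤ ∑ l, ∑ i, 2 ^ n * (Real.cos (Real.pi / 8) ^ 2) ^ S.card * ‖WithLp.toLp 2 (ψ l i)‖ ^ 2 :=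
        Finset.sum_le_sum fun l _ => Finset.sum_le_sum fun i _ =>
          sum_norm_jointOperator_le P S b hb (ψ l i)
    _ = _ := by
        simp only [← Finset.mul_sum, hψ1]
        ring

/-! ### From winning on a fixed set to tolerating a fraction of failures -/

theorem failedRounds_add_card (x y z : Bits n) :
    failedRounds x y z + (Finset.univ.filter fun i => y i = x i ∧ z i = x i).card = n := by
  have := Finset.card_filter_add_card_filter_not (s := (Finset.univ : Finset (Fin n)))
    (fun i => y i = x i ∧ z i = x i)
  rw [Finset.card_univ, Fintype.card_fin] at this
  rw [failedRounds, add_comm]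
  exact this

theorem agreeOn_iff_subset (S : Finset (Fin n)) (x y z : Bits n) :
    AgreeOn S x y ∧ AgreeOn S x z
      ↔ S ⊆ Finset.univ.filter fun i => y i = x i ∧ z i = x i := by
  simp only [Finset.subset_iff, Finset.mem_filter, Finset.mem_univ, true_and]
  exact ⟨fun h i hi => ⟨(h.1 i hi).symm, (h.2 i hi).symm⟩,
    fun h => ⟨fun i hi => (h hi).1.symm, fun i hi => (h hi).2.symm⟩⟩

/-- A weighted count of the sets on which all rounds are won dominates the event that few rounds
fail. -/
theorem rpow_le_sum_agree {δ t : ℝ} (ht : 0 ≤ t) {x y z : Bits n}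
    (h : (failedRounds x y z : ℝ) ≤ δ * n) :
    (1 + t) ^ ((1 - δ) * n) ≤ ∑ S : Finset (Fin n),
      if AgreeOn S x y ∧ AgreeOn S x z then t ^ S.card else 0 := by
  set W := Finset.univ.filter fun i => y i = x i ∧ z i = x i with hW
  have h1 : (∑ S : Finset (Fin n), if AgreeOn S x y ∧ AgreeOn S x z then t ^ S.card else 0)
      = (1 + t) ^ W.card := by
    rw [← Finset.sum_filter]
    have : (Finset.univ.filter fun S : Finset (Fin n) => AgreeOn S x y ∧ AgreeOn S x z)
        = W.powerset := by
      ext S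
      rw [Finset.mem_filter, Finset.mem_powerset, agreeOn_iff_subset]
      simp [hW]
    -- Binomial theorem over the subsets of the set `W` of won rounds.
    rw [this, add_comm, ← Finset.sum_pow_mul_eq_add_pow]
    simp
  rw [h1, ← Real.rpow_natCast]
  refine Real.rpow_le_rpow_of_exponent_le (by linarith) ?_
  have h2 : (failedRounds x y z : ℝ) + W.card = n := by exact_mod_cast failedRounds_add_card x y z
  linarith

/-- Markov's inequality for the generating function of the number of won rounds: its expectation is
the sum over `S` of `t ^ |S|` times the probability of winning on `S`, and `β ^ |S|` bounds the
latter. -/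
theorem successProb_mul_rpow_le (P : BB84Protocol n L R) {σ : Matrix L L ℂ} {τ : Matrix R R ℂ}
    (hσ : IsDensity σ) (hτ : IsDensity τ) (δ : ℝ) {t : ℝ} (ht : 0 ≤ t) :
    successProb δ P (σ ⊗ₖ τ) * (1 + t) ^ ((1 - δ) * n)
      ≤ (1 + t * Real.cos (Real.pi / 8) ^ 2) ^ n := by
  set β := Real.cos (Real.pi / 8) ^ 2 with hβ
  have h1 : ∀ θ x y z, (if (failedRounds x y z : ℝ) ≤ δ * n then
        outputProb P (σ ⊗ₖ τ) θ x y z else 0) * (1 + t) ^ ((1 - δ) * n)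
      ≤ ∑ S : Finset (Fin n), t ^ S.card * if AgreeOn S x y ∧ AgreeOn S x z then
        outputProb P (σ ⊗ₖ τ) θ x y z else 0 := by
    intro θ x y z
    have h0 := outputProb_nonneg P hσ hτ θ x y z
    split_ifs with h
    · refine (mul_le_mul_of_nonneg_left (rpow_le_sum_agree ht h) h0).trans_eq ?_
      rw [Finset.mul_sum]
      refine Finset.sum_congr rfl fun S _ => ?_
      split_ifs <;> ring
    · rw [zero_mul]
      refine Finset.sum_nonneg fun S _ => mul_nonneg (pow_nonneg ht _) ?_
      split_ifs
      exacts [h0, le_rfl]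
  have h2 : (∑ θ, ∑ x, ∑ y, ∑ z, if (failedRounds x y z : ℝ) ≤ δ * n then
        outputProb P (σ ⊗ₖ τ) θ x y z else 0) * (1 + t) ^ ((1 - δ) * n)
      ≤ 2 ^ n * 2 ^ n * (1 + t * β) ^ n := by
    calc _ ≤ ∑ θ, ∑ x, ∑ y, ∑ z, ∑ S : Finset (Fin n), t ^ S.card *
            if AgreeOn S x y ∧ AgreeOn S x z then outputProb P (σ ⊗ₖ τ) θ x y z else 0 := by
          simp only [Finset.sum_mul]
          exact Finset.sum_le_sum fun θ _ => Finset.sum_le_sum fun x _ =>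
            Finset.sum_le_sum fun y _ => Finset.sum_le_sum fun z _ => h1 θ x y z
      _ = ∑ S : Finset (Fin n), t ^ S.card * ∑ θ, ∑ x, ∑ y, ∑ z,
            if AgreeOn S x y ∧ AgreeOn S x z then outputProb P (σ ⊗ₖ τ) θ x y z else 0 := by
          simp only [Finset.mul_sum]
          simp only [Finset.sum_comm (t := (Finset.univ : Finset (Finset (Fin n))))]
      _ ≤ ∑ S : Finset (Fin n), t ^ S.card * (2 ^ n * 2 ^ n * β ^ S.card) :=
          Finset.sum_le_sum fun S _ => mul_le_mul_of_nonneg_left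
            (sum_outputProb_agree_le P S hσ hτ) (pow_nonneg ht _)
      _ = 2 ^ n * 2 ^ n * ∑ S : Finset (Fin n), (t * β) ^ S.card := by
          rw [Finset.mul_sum]
          exact Finset.sum_congr rfl fun S _ => by rw [mul_pow]; ring
      _ = 2 ^ n * 2 ^ n * (1 + t * β) ^ n := by
          have := Finset.sum_pow_mul_eq_add_pow (t * β) 1 (Finset.univ : Finset (Fin n))
          simp only [one_pow, mul_one, Finset.powerset_univ, Finset.card_univ,
            Fintype.card_fin] at this
          rw [this, add_comm]
  rw [successProb, div_mul_eq_mul_div, div_le_iff₀ (by positivity)]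
  linarith

theorem two_rpow_binEntropyBits (p : ℝ) :
    (2 : ℝ) ^ binEntropyBits p = Real.exp (Real.binEntropy p) := by
  rw [Real.rpow_def_of_pos (by norm_num), binEntropyBits,
    mul_div_cancel₀ _ (Real.log_pos (by norm_num)).ne']

theorem half_le_cos_sq : 1 / 2 ≤ Real.cos (Real.pi / 8) ^ 2 := by
  rw [cos_sq_pi_div_eight]
  have : 0 ≤ (√2)⁻¹ := by positivity
  linarith

/-- The success probability with a product resource state. -/
theorem successProb_product_le (P : BB84Protocol n L R) {σ : Matrix L L ℂ} {τ : Matrix R R ℂ}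
    (hσ : IsDensity σ) (hτ : IsDensity τ) {δ : ℝ} (hδ₀ : 0 ≤ δ) (hδ₁ : δ ≤ 1 / 2) :
    successProb δ P (σ ⊗ₖ τ)
      ≤ ((2 : ℝ) ^ binEntropyBits δ * Real.cos (Real.pi / 8) ^ 2) ^ n := by
  rw [two_rpow_binEntropyBits]
  have hβ := half_le_cos_sq
  -- At `δ = 0` the weight `t` below would be infinite; there success means winning every round, and
  -- `S = univ` gives `β ^ n` directly.
  rcases hδ₀.eq_or_lt with h0 | h0
  · subst h0
    rw [Real.binEntropy_zero, Real.exp_zero, one_mul, successProb, div_le_iff₀ (by positivity)]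
    have h := sum_outputProb_agree_le P Finset.univ hσ hτ
    rw [Finset.card_univ, Fintype.card_fin] at h
    refine le_trans (le_of_eq ?_) (h.trans_eq (mul_comm _ _))
    refine Finset.sum_congr rfl fun θ _ => Finset.sum_congr rfl fun x _ =>
      Finset.sum_congr rfl fun y _ => Finset.sum_congr rfl fun z _ => ?_
    congr 1
    rw [zero_mul, agreeOn_iff_subset, Finset.univ_subset_iff, Finset.filter_eq_self,
      Nat.cast_nonpos, failedRounds, Finset.card_eq_zero, Finset.filter_eq_empty_iff]
    simp
  · set β := Real.cos (Real.pi / 8) ^ 2 with hβ'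
    have h1δ : 0 < 1 - δ := by linarith
    -- This is the weight `t` with `1 + t = (1 - δ)/δ`; it is nonnegative exactly because `δ ≤ 1/2`.
    have ht : 0 ≤ (1 - 2 * δ) / δ := by
      apply div_nonneg _ h0.le
      linarith
    have h := successProb_mul_rpow_le P hσ hτ δ ht
    rw [← hβ'] at h
    have e1 : 1 + (1 - 2 * δ) / δ = (1 - δ) / δ := by field_simp; ring
    -- After clearing `δ` this is `δ(1 - β) ≤ δβ`, that is, `β ≥ 1/2`.
    have e2 : 1 + (1 - 2 * δ) / δ * β ≤ β / δ := by
      have : 1 + (1 - 2 * δ) / δ * β = (δ * (1 - β) + β * (1 - δ)) / δ := by field_simp; ring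
      rw [this]
      gcongr
      nlinarith
    -- From `exp (binEntropy δ) = δ^{-δ} (1 - δ)^{-(1 - δ)}` the powers of `1 - δ` cancel and `1/δ`
    -- remains.
    have e3 : β / δ = (Real.exp (Real.binEntropy δ) * β) * ((1 - δ) / δ) ^ (1 - δ) := by
      rw [Real.rpow_def_of_pos (by positivity), Real.log_div h1δ.ne' h0.ne', mul_right_comm,
        ← Real.exp_add, Real.binEntropy, Real.log_inv, Real.log_inv]
      have : δ * -Real.log δ + (1 - δ) * -Real.log (1 - δ)
          + (Real.log (1 - δ) - Real.log δ) * (1 - δ) = -Real.log δ := by ring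
      rw [this, Real.exp_neg, Real.exp_log h0]
      ring
    have hpos : 0 < ((1 - δ) / δ) ^ ((1 - δ) * n) := Real.rpow_pos_of_pos (by positivity) _
    refine le_of_mul_le_mul_right ?_ hpos
    rw [e1] at h
    refine h.trans ?_
    calc (1 + (1 - 2 * δ) / δ * β) ^ n ≤ (β / δ) ^ n := by
          gcongr
      _ = _ := by
          rw [e3, mul_pow, Real.rpow_mul (by positivity), Real.rpow_natCast]

/-! ### From product states to separable states and robustness -/

theorem outputProb_combination (P : BB84Protocol n L R) (a b : ℝ)
    (ρ σ : Matrix (L × R) (L × R) ℂ) (θ x y z : Bits n) :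
    outputProb P (a • ρ + b • σ) θ x y z
      = a * outputProb P ρ θ x y z + b * outputProb P σ θ x y z := by
  have h : P.run (a • ρ + b • σ) (bb84Input θ x)
      = a • P.run ρ (bb84Input θ x) + b • P.run σ (bb84Input θ x) := by
    have := map_add (P.runLinear (bb84Input θ x)) (a • ρ) (b • σ)
    rw [LinearMap.map_smul_of_tower, LinearMap.map_smul_of_tower] at this
    exact this
  simp only [outputProb, h, Matrix.add_apply, Matrix.smul_apply, Complex.add_re,
    Complex.smul_re, smul_eq_mul]

theorem successProb_combination (δ : ℝ) (P : BB84Protocol n L R) (a b : ℝ)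
    (ρ σ : Matrix (L × R) (L × R) ℂ) :
    successProb δ P (a • ρ + b • σ) = a * successProb δ P ρ + b * successProb δ P σ := by
  have h : ∀ θ x y z, (if (failedRounds x y z : ℝ) ≤ δ * n then
      outputProb P (a • ρ + b • σ) θ x y z else 0)
      = a * (if (failedRounds x y z : ℝ) ≤ δ * n then outputProb P ρ θ x y z else 0)
        + b * (if (failedRounds x y z : ℝ) ≤ δ * n then outputProb P σ θ x y z else 0) := by
    intro θ x y z
    split_ifs
    · exact outputProb_combination P a b ρ σ θ x y z
    · ring
  simp only [successProb, h, Finset.sum_add_distrib, ← Finset.mul_sum]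
  ring

/-- The success probability with a separable resource state. -/
theorem successProb_separable (P : BB84Protocol n L R) {δ : ℝ} (hδ₀ : 0 ≤ δ) (hδ₁ : δ ≤ 1 / 2)
    {κ : Matrix (L × R) (L × R) ℂ} (hκ : κ ∈ separableStates L R) :
    0 ≤ successProb δ P κ ∧ successProb δ P κ
      ≤ ((2 : ℝ) ^ binEntropyBits δ * Real.cos (Real.pi / 8) ^ 2) ^ n := by
  set B := ((2 : ℝ) ^ binEntropyBits δ * Real.cos (Real.pi / 8) ^ 2) ^ n with hB
  have hconv : Convex ℝ {κ : Matrix (L × R) (L × R) ℂ |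
      0 ≤ successProb δ P κ ∧ successProb δ P κ ≤ B} := by
    rintro x ⟨hx0, hx1⟩ y ⟨hy0, hy1⟩ a b ha hb hab
    change 0 ≤ successProb δ P _ ∧ successProb δ P _ ≤ B
    rw [successProb_combination]
    refine ⟨add_nonneg (mul_nonneg ha hx0) (mul_nonneg hb hy0), ?_⟩
    calc a * successProb δ P x + b * successProb δ P y ≤ a * B + b * B :=
          add_le_add (mul_le_mul_of_nonneg_left hx1 ha) (mul_le_mul_of_nonneg_left hy1 hb)
      _ = B := by rw [← add_mul, hab, one_mul]
  refine convexHull_min ?_ hconv hκ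
  rintro _ ⟨σ, τ, hσ, hτ, rfl⟩
  refine ⟨?_, successProb_product_le P hσ hτ hδ₀ hδ₁⟩
  refine div_nonneg (Finset.sum_nonneg fun θ _ => Finset.sum_nonneg fun x _ =>
    Finset.sum_nonneg fun y _ => Finset.sum_nonneg fun z _ => ?_) (by positivity)
  split_ifs
  exacts [outputProb_nonneg P hσ hτ θ x y z, le_rfl]

/-- The separable mixture carries `ρ` with weight `1/(1+s)`, and the term of `σ` is nonnegative, so
the separable bound loses only the factor `1 + s`. -/
theorem successProb_le_of_mem_robustnessSet (P : BB84Protocol n L R) {δ : ℝ} (hδ₀ : 0 ≤ δ)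
    (hδ₁ : δ ≤ 1 / 2) {ρ : Matrix (L × R) (L × R) ℂ} {s : ℝ} (hs : s ∈ robustnessSet ρ) :
    successProb δ P ρ
      ≤ (1 + s) * ((2 : ℝ) ^ binEntropyBits δ * Real.cos (Real.pi / 8) ^ 2) ^ n := by
  obtain ⟨hs0, σ, hσ, hτ⟩ := hs
  have h1 := (successProb_separable P hδ₀ hδ₁ hσ).1
  have h2 := (successProb_separable P hδ₀ hδ₁ hτ).2
  rw [successProb_combination] at h2
  have hpos : 0 < 1 + s := by linarith
  have h3 : 1 / (1 + s) * successProb δ P ρ + s / (1 + s) * successProb δ P σ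
      = (successProb δ P ρ + s * successProb δ P σ) / (1 + s) := by ring
  rw [h3, div_le_iff₀ hpos] at h2
  have := mul_nonneg hs0 h1
  linarith

end Success

end NLQC

end

theorem mainTheorem10 {L R : Type*} [Fintype L] [DecidableEq L] [Fintype R] [DecidableEq R]
    (n : ℕ) (δ γ : ℝ) (hδ₀ : 0 ≤ δ) (hδ₁ : δ ≤ 1 / 2) (hγ : γ < 1)
    (ρ : Matrix (L × R) (L × R) ℂ) (hρ : NLQC.IsDensity ρ)
    (P : NLQC.BB84Protocol n L R) (hP : 1 - γ ≤ NLQC.successProb δ P ρ) :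
    (n : ℝ) * (-Real.logb 2 ((2 : ℝ) ^ NLQC.binEntropyBits δ * Real.cos (Real.pi / 8) ^ 2))
      + Real.logb 2 (1 - γ) ≤ NLQC.logRobustness ρ := by
  have hβ := NLQC.half_le_cos_sq
  set B := (2 : ℝ) ^ NLQC.binEntropyBits δ * Real.cos (Real.pi / 8) ^ 2 with hB
  have hB0 : 0 < B := mul_pos (Real.rpow_pos_of_pos (by norm_num) _) (by linarith)
  have hBn : 0 < B ^ n := pow_pos hB0 n
  have h1 : (1 - γ) / B ^ n - 1 ≤ NLQC.robustness ρ := by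
    -- Nonemptiness matters: the real infimum of an empty set is `0` by convention, which would make
    -- the lower bound unjustified.
    refine le_csInf (NLQC.robustnessSet_nonempty hρ) fun s hs => ?_
    have := hP.trans (NLQC.successProb_le_of_mem_robustnessSet P hδ₀ hδ₁ hs)
    rw [← div_le_iff₀ hBn] at this
    linarith
  have hγ' : 0 < 1 - γ := by linarith
  have h2 : Real.logb 2 ((1 - γ) / B ^ n) ≤ NLQC.logRobustness ρ :=
    Real.logb_le_logb_of_le (by norm_num) (div_pos hγ' hBn) (by linarith)
  rw [Real.logb_div hγ'.ne' hBn.ne', Real.logb_pow] at h2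
  linarith
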